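/- Let $k$ be a field, $A$ an abelian group, and $S=k[x_0,\dots,x_n]$ graded by $A$ with $\deg x_i\in A$. Let $E=\Lambda_k(e_0,\dots,e_n)$ be the exterior algebra, $A\oplus\mathbb Z$-graded by $\deg e_i=(-\deg x_i;-1)$, and let $\omega_E=\operatorname{Hom}_k(E,k)$ with its induced grading and $E$-module structure. For an $A$-graded $S$-module $M$ put $\operatorname{Eff}(M)=\{a\in A: M_a\neq 0\}$, and write $a\ge a'$ if $a-a'\in\operatorname{Eff}(S)$. The module $M$ is bounded below in $A$-degrees if there is a homomorphism $\theta:A\to\mathbb Z$ with $\theta(\deg x_i)>0$ for all $i$ and $\bigoplus_{\theta(a)=i}M_a=0$ for $i\ll 0$. For $a\in A$ let $$K_a(M)=\ker\Big(M_a\otimes_k\omega_E(-a;0)\to \bigoplus_{b\in A}M_b\otimes_k\omega_E(-b;0),\quad m\otimes f\mapsto\sum_{i=0}^n x_im\otimes e_if\Big),$$ an $A\oplus\mathbb Z$-graded $E$-module. If $M$ is bounded below in $A$-degrees and $a$ is a minimal element of $\operatorname{Eff}(M)$, the ($a$-)strongly linear strand of the minimal free resolution of $M$ is, by definition, the complex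 $\mathbf L(K_a(M))$ of $S$-modules with terms and differential $$\mathbf L(K_a(M))_j=\bigoplus_{c\in A}S(-c)\otimes_k K_a(M)_{(c;j)},\qquad s\otimes y\mapsto\sum_{i=0}^n x_is\otimes e_iy .$$ It vanishes in negative degrees; its length is the largest $j$ with $\mathbf L(K_a(M))_j\ne0$. Let $W\subseteq S$ be the $k$-span of $x_0,\dots,x_n$, and let $$R_a(M)=\{w\otimes m\in W\otimes_kM_a : wm=0\text{ in }M\},$$ regarded as a closed subvariety of the affine space $\operatorname{Spec}k[W\otimes_kM_a]$: a point with residue field $\kappa$ lies in $R_a(M)$ if the corresponding element of $\kappa\otimes_kW\otimes_kM_a$ is of the form $w\otimes m$ with $w\in\kappa\otimes_k W$, $m\in\kappa\otimes_k M_a$ and $wm=0$ in $\kappa\otimes_kM$. **Theorem (Multigraded Linear Syzygy Theorem).** Let $M$ be an $A$-graded $S$-module that is bounded below in $A$-degrees, and let $a$ be a minimal element of $\operatorname{Eff}(M)$. The length of the strongly linear strand $\mathbf L(K_a(M))$ of the minimal free resolution of $M$ is at most $$\max\{\dim_kM_a-1,\ \dim R_a(M)\}$$ (where the bound is $\infty$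 if $\dim_kM_a=\infty$). -/

import Mathlib

open scoped TensorProduct DirectSum
open CategoryTheory

set_option linter.unusedSectionVars false

noncomputable section

namespace MultigradedLST

universe u v t

/-! ### Gradings

`k` is a field, `A` an abelian group, `S = k[x_0, …, x_n]` is `MvPolynomial (Fin (n + 1)) k`, graded
by `deg x_i = w i`; its degree `c` part is `MvPolynomial.weightedHomogeneousSubmodule k w c`. -/

section Gradings

variable {k : Type u} [Field k] {A : Type t} [AddCommGroup A] {n : ℕ} (w : Fin (n + 1) → A)
variable {M : Type v} [AddCommGroup M] [Module k M]

/-- `Eff(M)`: the set of degrees `a` with `M_a ≠ 0`. -/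
def Eff (ℳ : A → Submodule k M) : Set A := {a | ℳ a ≠ ⊥}

/-- The relation `a ≥ b` given by `a - b ∈ Eff(S)`. -/
def EffGE (k : Type u) [Field k] (w : Fin (n + 1) → A) (a b : A) : Prop :=
  a - b ∈ Eff (MvPolynomial.weightedHomogeneousSubmodule k w)

/-- `a` is a minimal element of `Eff(M)`. -/
def IsMinimalEff (ℳ : A → Submodule k M) (a : A) : Prop :=
  a ∈ Eff ℳ ∧ ∀ b ∈ Eff ℳ, EffGE k w a b → b = a

/-- `M` is bounded below in `A`-degrees: some homomorphism `θ : A → ℤ` makes the grading of `S`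
positive and satisfies `⨁_{θ(a) = i} M_a = 0` for `i ≪ 0`. -/
def BoundedBelow (ℳ : A → Submodule k M) : Prop :=
  ∃ θ : A →+ ℤ, (∀ i, 0 < θ (w i)) ∧ ∃ N : ℤ, ∀ a, θ a < N → ℳ a = ⊥

end Gradings

/-! ### The exterior algebra `E` and the module `ω_E` -/

section Exterior

/-- The exterior algebra `E` on `e_0, …, e_n`. -/
abbrev ExtAlg (k : Type u) [Field k] (n : ℕ) : Type u := ExteriorAlgebra k (Fin (n + 1) → k)

/-- The exterior variable `e_i`. -/
def e (k : Type u) [Field k] {n : ℕ} (i : Fin (n + 1)) : ExtAlg k n :=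
  ExteriorAlgebra.ι k (Pi.single i 1)

variable (k : Type u) [Field k] {A : Type t} [AddCommGroup A] {n : ℕ} (w : Fin (n + 1) → A)

/-- The component `E_{(c; j)}` for the `A ⊕ ℤ`-grading with `deg e_i = (-deg x_i; -1)`: it is spanned
by the monomials `e_{i_1} ⋯ e_{i_r}` with `-(w i_1 + ⋯ + w i_r) = c` and `-r = j`. -/
def extComp (c : A) (j : ℤ) : Submodule k (ExtAlg k n) :=
  Submodule.span k {y | ∃ l : List (Fin (n + 1)),
    -(l.map w).sum = c ∧ -(l.length : ℤ) = j ∧ y = (l.map (e k)).prod}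

/-- `ω_E = Hom_k(E, k)`. -/
def OmegaE (k : Type u) [Field k] (n : ℕ) : Type u := Module.Dual k (ExtAlg k n)

variable {k} in
/-- An element of `ω_E` as a functional. -/
def OmegaE.toDual (f : OmegaE k n) : Module.Dual k (ExtAlg k n) := f

instance : AddCommGroup (OmegaE k n) := inferInstanceAs (AddCommGroup (Module.Dual k (ExtAlg k n)))

instance : Module k (OmegaE k n) := inferInstanceAs (Module k (Module.Dual k (ExtAlg k n)))

/-- The left `E`-module structure of `ω_E`. As a right module, `ω_E` has `(f e) y = f (e y)`; the
associated left action is `e f = (-1)^{aux(e) aux(f)} f e` on homogeneous elements. As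
`e y = (-1)^{aux(e) aux(y)} y e`, and only `aux(y) = -aux(f) - aux(e)` matters, this is
`(e f) y = (-1)^{aux(e)} f (y e)`, where `e ↦ (-1)^{aux(e)} e` is the grade involution of `E`. -/
instance : Module (ExtAlg k n) (OmegaE k n) where
  smul x f := f.toDual ∘ₗ LinearMap.mulRight k (CliffordAlgebra.involute x)
  one_smul f := by
    refine LinearMap.ext fun y => ?_
    change f.toDual (y * CliffordAlgebra.involute 1) = _
    rw [map_one, mul_one]; rfl
  mul_smul x x' f := by
    refine LinearMap.ext fun y => ?_
    change f.toDual (y * CliffordAlgebra.involute (x * x')) =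
      f.toDual (y * CliffordAlgebra.involute x * CliffordAlgebra.involute x')
    rw [map_mul CliffordAlgebra.involute x x', mul_assoc]
  smul_zero x := rfl
  smul_add x f g := rfl
  add_smul x x' f := by
    refine LinearMap.ext fun y => ?_
    change f.toDual (y * CliffordAlgebra.involute (x + x')) =
      f.toDual (y * CliffordAlgebra.involute x) +
      f.toDual (y * CliffordAlgebra.involute x')
    rw [map_add, mul_add, map_add]
  zero_smul f := by
    refine LinearMap.ext fun y => ?_
    change f.toDual (y * CliffordAlgebra.involute 0) = 0
    rw [map_zero, mul_zero, map_zero]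

theorem OmegaE.smul_apply (x : ExtAlg k n) (f : OmegaE k n) (y : ExtAlg k n) :
    (x • f).toDual y =
      f.toDual (y * CliffordAlgebra.involute x) := rfl

instance : SMulCommClass k (ExtAlg k n) (OmegaE k n) where
  smul_comm _ _ _ := rfl

instance : SMulCommClass (ExtAlg k n) k (OmegaE k n) where
  smul_comm _ _ _ := rfl

instance : IsScalarTower k (ExtAlg k n) (OmegaE k n) where
  smul_assoc r x f := by
    refine LinearMap.ext fun y => ?_
    change f.toDual (y * CliffordAlgebra.involute (r • x)) =
      r • f.toDual (y * CliffordAlgebra.involute x)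
    rw [map_smul, mul_smul_comm, map_smul]

/-- The component `(ω_E)_{(c; j)}`: the functionals that vanish on every `E_{(c'; j')}` with
`(c'; j') ≠ (-c; -j)`. -/
def omegaComp (c : A) (j : ℤ) : Submodule k (OmegaE k n) where
  carrier := {f | ∀ c' j', (c', j') ≠ (-c, -j) → ∀ y ∈ extComp k w c' j',
    f.toDual y = 0}
  zero_mem' := fun _ _ _ _ _ => rfl
  add_mem' := fun {f g} hf hg c' j' h y hy => by
    change f.toDual y + g.toDual y = 0
    exact (congrArg₂ (· + ·) (hf c' j' h y hy) (hg c' j' h y hy)).trans (add_zero 0)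
  smul_mem' := fun r f hf c' j' h y hy => by
    change r • f.toDual y = 0
    exact (congrArg (r • ·) (hf c' j' h y hy)).trans (smul_zero r)

theorem mul_e_mem_extComp (i : Fin (n + 1)) {c : A} {j : ℤ} {y : ExtAlg k n}
    (hy : y ∈ extComp k w c j) : y * e k i ∈ extComp k w (c - w i) (j - 1) := by
  induction hy using Submodule.span_induction with
  | mem y h =>
    obtain ⟨l, h1, h2, rfl⟩ := h
    refine Submodule.subset_span ⟨l ++ [i], ?_, ?_, ?_⟩
    · rw [← h1]; simp; abel
    · rw [← h2]; simp; ring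
    · simp
  | zero => simp
  | add y z _ _ hy hz => rw [add_mul]; exact add_mem hy hz
  | smul r y _ hy => rw [smul_mul_assoc]; exact Submodule.smul_mem _ _ hy

theorem involute_e (i : Fin (n + 1)) : CliffordAlgebra.involute (e k i) = -e k i :=
  CliffordAlgebra.involute_ι _

/-- `e_i` acts on `ω_E` with degree `(-deg x_i; -1)`. -/
theorem e_smul_mem_omegaComp (i : Fin (n + 1)) {c : A} {j : ℤ} {f : OmegaE k n}
    (hf : f ∈ omegaComp k w c (j + 1)) : e k i • f ∈ omegaComp k w (c - w i) j := by
  intro c' j' h y hy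
  rw [OmegaE.smul_apply, involute_e, mul_neg, map_neg, neg_eq_zero]
  refine hf (c' - w i) (j' - 1) ?_ _ (mul_e_mem_extComp k w i hy)
  intro h'
  apply h
  rw [Prod.mk.injEq] at h' ⊢
  refine ⟨?_, by omega⟩
  rw [neg_sub, sub_eq_iff_eq_add.mp h'.1]; abel

theorem ι_mul_eq (m : Fin (n + 1) → k) (x : ExtAlg k n) :
    ExteriorAlgebra.ι k m * x = CliffordAlgebra.involute x * ExteriorAlgebra.ι k m := by
  induction x using ExteriorAlgebra.induction with
  | algebraMap r =>
    rw [AlgHom.commutes]; exact (Algebra.commutes r _).symm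
  | ι m' =>
    have h : CliffordAlgebra.involute (ExteriorAlgebra.ι k m') = -ExteriorAlgebra.ι k m' :=
      CliffordAlgebra.involute_ι _
    rw [h, neg_mul]
    exact eq_neg_of_add_eq_zero_left (ExteriorAlgebra.ι_add_mul_swap m m')
  | mul x y hx hy => rw [map_mul, ← mul_assoc, hx, mul_assoc, hy, mul_assoc]
  | add x y hx hy => rw [map_add, mul_add, add_mul, hx, hy]

end Exterior

/-! ### The functor `L` on `A ⊕ ℤ`-graded `E`-modules with trivial differential -/

section FunctorL

variable {k : Type u} [Field k] {A : Type t} [AddCommGroup A] [DecidableEq A] {n : ℕ}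
  (w : Fin (n + 1) → A)
variable {D : Type v} [AddCommGroup D] [Module k D] [Module (ExtAlg k n) D]
  [IsScalarTower k (ExtAlg k n) D]
variable (𝒟 : A → ℤ → Submodule k D)

/-- The components are compatible with the action of the elements `e_i` of degree `(-w i; -1)`. -/
def IsCompatible : Prop :=
  ∀ (i : Fin (n + 1)) (c : A) (j : ℤ), ∀ y ∈ 𝒟 c (j + 1), e k i • y ∈ 𝒟 (c - w i) j

/-- The term `L(D)_j = ⨁_c S(-c) ⊗_k D_{(c; j)}`. -/
abbrev LTerm (n : ℕ) (𝒟 : A → ℤ → Submodule k D) (j : ℤ) : Type (max u v t) :=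
  ⨁ c : A, (MvPolynomial (Fin (n + 1)) k ⊗[k] 𝒟 c j)

variable {w 𝒟}

/-- Multiplication by `e_i`, as a map `D_{(c; j + 1)} → D_{(c - w i; j)}`. -/
def eMul (h : IsCompatible w 𝒟) (i : Fin (n + 1)) (c : A) (j : ℤ) :
    𝒟 c (j + 1) →ₗ[k] 𝒟 (c - w i) j :=
  ((Algebra.lsmul k k D (e k i)).restrict (h i c j))

/-- The differential `s ⊗ d ↦ ∑ i, x_i s ⊗ e_i d` of `L(D)`. -/
def LDiff (h : IsCompatible w 𝒟) (j : ℤ) :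
    LTerm n 𝒟 (j + 1) →ₗ[MvPolynomial (Fin (n + 1)) k] LTerm n 𝒟 j :=
  DirectSum.toModule _ A _ fun c => ∑ i : Fin (n + 1),
    (DirectSum.lof (MvPolynomial (Fin (n + 1)) k) A
      (fun c => MvPolynomial (Fin (n + 1)) k ⊗[k] 𝒟 c j) (c - w i)) ∘ₗ
    TensorProduct.AlgebraTensorModule.map
      (LinearMap.mulLeft (MvPolynomial (Fin (n + 1)) k) (MvPolynomial.X i : MvPolynomial (Fin (n + 1)) k))
      (eMul h i c j)

theorem LDiff_lof (h : IsCompatible w 𝒟) (j : ℤ) (c : A) (s : MvPolynomial (Fin (n + 1)) k)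
    (y : 𝒟 c (j + 1)) :
    LDiff h j (DirectSum.lof (MvPolynomial (Fin (n + 1)) k) A
        (fun c => MvPolynomial (Fin (n + 1)) k ⊗[k] 𝒟 c (j + 1)) c (s ⊗ₜ y)) =
      ∑ i, DirectSum.lof (MvPolynomial (Fin (n + 1)) k) A
        (fun c => MvPolynomial (Fin (n + 1)) k ⊗[k] 𝒟 c j) (c - w i)
        ((MvPolynomial.X i * s) ⊗ₜ eMul h i c j y) := by
  simp [LDiff, DirectSum.toModule_lof]

theorem lof_congr (j : ℤ) {c c' : A} (hc : c = c') (s : MvPolynomial (Fin (n + 1)) k)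
    (y : 𝒟 c j) (y' : 𝒟 c' j) (hy : (y : D) = y') :
    DirectSum.lof (MvPolynomial (Fin (n + 1)) k) A
        (fun c => MvPolynomial (Fin (n + 1)) k ⊗[k] 𝒟 c j) c (s ⊗ₜ y) =
      DirectSum.lof (MvPolynomial (Fin (n + 1)) k) A
        (fun c => MvPolynomial (Fin (n + 1)) k ⊗[k] 𝒟 c j) c' (s ⊗ₜ y') := by
  subst hc
  rw [Subtype.ext hy]

theorem LDiff_comp (h : IsCompatible w 𝒟) (j : ℤ) : LDiff h j ∘ₗ LDiff h (j + 1) = 0 := by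
  refine DirectSum.linearMap_ext _ fun c => ?_
  refine TensorProduct.AlgebraTensorModule.ext fun s y => ?_
  rw [LinearMap.comp_apply, LinearMap.comp_apply, LDiff_lof, map_sum]
  simp only [LDiff_lof, LinearMap.zero_comp, LinearMap.zero_apply]
  -- the summand for the ordered pair (i, l)
  set T : Fin (n + 1) → Fin (n + 1) → LTerm n 𝒟 j := fun i l =>
    DirectSum.lof (MvPolynomial (Fin (n + 1)) k) A
        (fun c => MvPolynomial (Fin (n + 1)) k ⊗[k] 𝒟 c j) (c - w i - w l)
        ((MvPolynomial.X l * (MvPolynomial.X i * s)) ⊗ₜ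
          eMul h l (c - w i) j (eMul h i c (j + 1) y)) with hT
  have hval : ∀ i l, ((eMul h l (c - w i) j (eMul h i c (j + 1) y) : 𝒟 (c - w i - w l) j) : D) =
      (e k l * e k i) • (y : D) := fun i l => by
    rw [mul_smul]; rfl
  have hanti : ∀ i l, T i l = -T l i := fun i l => by
    rw [hT]
    dsimp only
    rw [← map_neg, ← TensorProduct.tmul_neg]
    have hs : (MvPolynomial.X l * (MvPolynomial.X i * s) : MvPolynomial (Fin (n + 1)) k) =
        MvPolynomial.X i * (MvPolynomial.X l * s) := by ring
    rw [hs]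
    refine lof_congr j (by abel) _ _ _ ?_
    rw [Submodule.coe_neg, hval, hval, ← neg_smul]
    congr 1
    exact eq_neg_of_add_eq_zero_left (ExteriorAlgebra.ι_add_mul_swap _ _)
  have hdiag : ∀ i, T i i = 0 := fun i => by
    rw [hT]
    dsimp only
    have : eMul h i (c - w i) j (eMul h i c (j + 1) y) = 0 := by
      refine Subtype.ext ?_
      rw [hval]
      have : e k i * e k i = 0 := ExteriorAlgebra.ι_sq_zero _
      rw [this, zero_smul]; rfl
    rw [this, TensorProduct.tmul_zero, map_zero]
  change ∑ i, ∑ l, T i l = 0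
  rw [← Fintype.sum_prod_type']
  refine Finset.sum_involution (fun p _ => (p.2, p.1)) ?_ ?_ ?_ ?_
  · rintro ⟨i, l⟩ _; rw [hanti i l]; exact neg_add_cancel _
  · rintro ⟨i, l⟩ _ h0 h1
    obtain rfl : l = i := congrArg Prod.fst h1
    exact h0 (hdiag l)
  · intro p _; exact Finset.mem_univ _
  · intro p _; rfl

/-- The complex `L(D)` of `S`-modules, for `D` with trivial differential. -/
def bggL (h : IsCompatible w 𝒟) : ChainComplex (ModuleCat (MvPolynomial (Fin (n + 1)) k)) ℤ :=
  ChainComplex.of (fun j => ModuleCat.of _ (LTerm n 𝒟 j)) (fun j => ModuleCat.ofHom (LDiff h j))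
    fun j => by
      rw [← ModuleCat.ofHom_comp, LDiff_comp]; rfl

end FunctorL

/-! ### `K_a(M)` and the strongly linear strand -/

section Strand

variable {k : Type u} [Field k] {A : Type t} [AddCommGroup A] {n : ℕ} (w : Fin (n + 1) → A)
variable {M : Type v} [AddCommGroup M] [Module k M] [Module (MvPolynomial (Fin (n + 1)) k) M]
  [IsScalarTower k (MvPolynomial (Fin (n + 1)) k) M]
variable (ℳ : A → Submodule k M) (a : A)

/-- The differential of `R(M)`, restricted to the summand `M_a ⊗ ω_E`, namely
`m ⊗ f ↦ ∑ i, x_i m ⊗ e_i f`. The tensor factors are written in the order `ω_E ⊗ M`, so that the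
`E`-module structures are the ones of Mathlib; `⨁_b M_b ⊗ ω_E(-b; 0)` is, without its grading,
`ω_E ⊗ M`. -/
def dR : OmegaE k n ⊗[k] ℳ a →ₗ[k] OmegaE k n ⊗[k] M :=
  ∑ i : Fin (n + 1), TensorProduct.map (Algebra.lsmul k k (OmegaE k n) (e k i))
    ((Algebra.lsmul k k M (MvPolynomial.X i : MvPolynomial (Fin (n + 1)) k)) ∘ₗ (ℳ a).subtype)

theorem dR_smul (x : ExtAlg k n) (y : OmegaE k n ⊗[k] ℳ a) :
    dR ℳ a (x • y) = CliffordAlgebra.involute x • dR ℳ a y := by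
  induction y using TensorProduct.induction_on with
  | zero => simp
  | add y z hy hz => rw [smul_add, map_add, hy, hz, map_add, smul_add]
  | tmul f m =>
    rw [TensorProduct.smul_tmul']
    simp only [dR, LinearMap.sum_apply, TensorProduct.map_tmul, Finset.smul_sum,
      TensorProduct.smul_tmul', Algebra.lsmul_coe]
    refine Finset.sum_congr rfl fun i _ => ?_
    rw [smul_smul, smul_smul]
    congr 2
    exact ι_mul_eq k _ x

/-- The `E`-module `K_a(M) = ker (M_a ⊗ ω_E(-a; 0) → R(M))`. -/
def Kmod : Submodule (ExtAlg k n) (OmegaE k n ⊗[k] ℳ a) where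
  carrier := {y | dR ℳ a y = 0}
  zero_mem' := map_zero _
  add_mem' := fun {y z} (hy : dR ℳ a y = 0) (hz : dR ℳ a z = 0) => by
    change dR ℳ a (y + z) = 0
    rw [map_add, hy, hz, add_zero]
  smul_mem' := fun x y (hy : dR ℳ a y = 0) => by
    change dR ℳ a (x • y) = 0
    rw [dR_smul, hy, smul_zero]

/-- The component of degree `(c; j)` of `M_a ⊗ ω_E(-a; 0)`, namely `M_a ⊗ (ω_E)_{(c - a; j)}`. -/
def summandComp (c : A) (j : ℤ) : Submodule k (OmegaE k n ⊗[k] ℳ a) :=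
  LinearMap.range (LinearMap.rTensor (ℳ a) (omegaComp k w (c - a) j).subtype)

/-- The component `K_a(M)_{(c; j)}`, inside `M_a ⊗ ω_E(-a; 0)`. -/
def Kcomp (c : A) (j : ℤ) : Submodule k (OmegaE k n ⊗[k] ℳ a) :=
  (Kmod ℳ a).restrictScalars k ⊓ summandComp w ℳ a c j

theorem e_smul_mem_summandComp (i : Fin (n + 1)) (c : A) (j : ℤ) {y : OmegaE k n ⊗[k] ℳ a}
    (hy : y ∈ summandComp w ℳ a c (j + 1)) :
    e k i • y ∈ summandComp w ℳ a (c - w i) j := by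
  obtain ⟨z, rfl⟩ := hy
  induction z using TensorProduct.induction_on with
  | zero => simp
  | add z z' hz hz' => rw [map_add, smul_add]; exact add_mem hz hz'
  | tmul f m =>
    have hf := e_smul_mem_omegaComp k w i f.2
    rw [sub_right_comm] at hf
    exact ⟨(⟨e k i • (f : OmegaE k n), hf⟩ : omegaComp k w (c - w i - a) j) ⊗ₜ m, rfl⟩

theorem Kcomp_compatible : IsCompatible w (Kcomp w ℳ a) :=
  fun i c j _ hy => ⟨(Kmod ℳ a).smul_mem (e k i) hy.1, e_smul_mem_summandComp w ℳ a i c j hy.2⟩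

/-- The `a`-strongly linear strand `L(K_a(M))` of the minimal free resolution of `M`. -/
def stronglyLinearStrand [DecidableEq A] :
    ChainComplex (ModuleCat (MvPolynomial (Fin (n + 1)) k)) ℤ :=
  bggL (Kcomp_compatible w ℳ a)

end Strand

/-- The length of a complex `C_0 ← C_1 ← ⋯` (zero in negative degrees, as strongly linear strands
are): the supremum of the `j` with `C_j ≠ 0`. -/
def complexLength {R : Type*} [Ring R] (C : ChainComplex (ModuleCat R) ℤ) : ℕ∞ :=
  ⨆ (j : ℕ) (_ : Nontrivial (C.X (j : ℤ))), (j : ℕ∞)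

/-! ### The variety of rank one linear syzygies -/

section RankOne

variable {k : Type u} [Field k] {A : Type t} {n : ℕ}
variable {M : Type v} [AddCommGroup M] [Module k M] [Module (MvPolynomial (Fin (n + 1)) k) M]
variable (ℳ : A → Submodule k M) (a : A)

/-- The index set of a basis of `M_a`. -/
abbrev BasisIndex : Type v := Module.Basis.ofVectorSpaceIndex k (ℳ a)

/-- The coordinate ring `k[W ⊗ M_a]`, where `W` is spanned by `x_0, …, x_n`: the variable `(i, l)` is
the coordinate function at the element `x_i ⊗ b_l` of the basis of `W ⊗ M_a`. -/
abbrev CoordRing (n : ℕ) (ℳ : A → Submodule k M) (a : A) : Type (max u v) :=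
  MvPolynomial (Fin (n + 1) × BasisIndex ℳ a) k

/-- `R_a(M)`, as a subset of `Spec k[W ⊗ M_a]`. A point `p` with residue field `κ` is an element of
`κ ⊗ (W ⊗ M_a)`; it belongs to `R_a(M)` when this element has the form `w ⊗ m`, with `w = ∑ u_i x_i`
and `m = ∑ v_l b_l` over `κ`, and `w m = 0` in `κ ⊗ M`. -/
def rankOneSyzygies (n : ℕ) {M : Type v} [AddCommGroup M] [Module k M]
    [Module (MvPolynomial (Fin (n + 1)) k) M] (ℳ : A → Submodule k M) (a : A) :
    Set (PrimeSpectrum (CoordRing n ℳ a)) :=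
  {p | ∃ (u : Fin (n + 1) → p.asIdeal.ResidueField) (v : BasisIndex ℳ a →₀ p.asIdeal.ResidueField),
    (∀ i l, algebraMap (CoordRing n ℳ a) p.asIdeal.ResidueField (MvPolynomial.X (i, l)) = u i * v l) ∧
    ∑ i, v.sum (fun l c => (u i * c) ⊗ₜ[k] ((MvPolynomial.X i : MvPolynomial (Fin (n + 1)) k) •
      (Module.Basis.ofVectorSpace k (ℳ a) l : M))) =
      (0 : p.asIdeal.ResidueField ⊗[k] M)}

end RankOne

end MultigradedLST

end

open scoped TensorProduct

noncomputable section

namespace MultigradedLST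

/-! ### Regularity along a sequence of anticommuting elements -/

section Regularity

variable {X : Type*} [Ring X] (ν z : ℕ → X)

/-! Let `N = n + 1`, `m = dim M_a`, and let `b_l` be a basis of `M_a` with dual coordinates `X_l`.
An element of `K_a(M)` of degree `j` is a family of functionals `f_l` on `E`, supported on products
of `j` exterior variables, with `∑ φ(x_i b_l) f_l(y e_i) = 0` for all functionals `φ` on `M` and all
`y`. So the family annihilates the left submodule generated by the elements `∑ φ(x_i b_l) e_i ⊗
X_l`. The point is that for `j ≥ m` a nonzero such family forces `dim R_a(M) ≥ j`.

Over an algebraically closed `Ω` with enough indeterminates, take `r = N + 1 - j` generic `φ`'s.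
They give elements `ν_a` of `Ω[X] ⊗ E`, linear in the `X`'s and in the `e`'s.

If the `ν_a(u)` are independent at every point `u ≠ 0`, then away from the origin the `ν_a` are part
of a basis of exterior variables, and whatever their product kills lies in the left ideal they
generate. Since the `X_l` form a regular sequence, this extends across the origin in positive
polynomial degree (`RegularityData.regular_pair`). For a product `Y` of `j` exterior variables, `X_l
⊗ Y` times all the `ν_a` has `N + 1` exterior factors, so it is zero. Hence `X_l ⊗ Y` lies in the
left ideal and `f_l(Y) = 0` (`functional_eq_zero`).

Otherwise the `ν_a(u)` are dependent at some `u ≠ 0`. A parameter count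
(`exists_rank_one_of_dependent`) then produces a rank one syzygy `w ⊗ u` whose coordinates have
transcendence degree at least `N + 1 - r = j`. The closure of this point lies in `R_a(M)`, and
Noether normalization turns transcendence degree into Krull dimension. -/

/-- The left ideal generated by `ν 0, …, ν (i - 1)` and `z 0, …, z (b - 1)`. -/
def truncIdeal (i b : ℕ) : Ideal X := Ideal.span (ν '' Set.Iio i ∪ z '' Set.Iio b)

variable {ν z}

theorem Iio_succ_image {Y : Type*} (f : ℕ → Y) (i : ℕ) :
    f '' Set.Iio (i + 1) = insert (f i) (f '' Set.Iio i) := by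
  rw [← Set.image_insert_eq]
  congr 1
  ext x
  simp only [Set.mem_Iio, Set.mem_insert_iff]
  omega

theorem mem_truncIdeal_succ_left {i b : ℕ} {x : X} :
    x ∈ truncIdeal ν z (i + 1) b ↔ ∃ g, ∃ y ∈ truncIdeal ν z i b, x = g * ν i + y := by
  rw [truncIdeal, Iio_succ_image, Set.insert_union, Ideal.mem_span_insert]; rfl

theorem mem_truncIdeal_succ_right {i b : ℕ} {x : X} :
    x ∈ truncIdeal ν z i (b + 1) ↔ ∃ g, ∃ y ∈ truncIdeal ν z i b, x = g * z b + y := by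
  rw [truncIdeal, Iio_succ_image, Set.union_insert, Ideal.mem_span_insert]; rfl

theorem truncIdeal_zero : truncIdeal ν z 0 0 = ⊥ := by simp [truncIdeal]

theorem truncIdeal_mul_mem (hz : ∀ c x, z c * x = x * z c) (hν : ∀ a b, ν a * ν b = -(ν b * ν a))
    {i b : ℕ} {x : X} (hx : x ∈ truncIdeal ν z i b) (a : ℕ) : x * ν a ∈ truncIdeal ν z i b := by
  refine Submodule.span_induction ?_ ?_ ?_ ?_ hx
  · rintro _ (⟨c, hc, rfl⟩ | ⟨c, hc, rfl⟩)
    · rw [hν, ← neg_mul]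
      exact Ideal.mul_mem_left _ _ (Ideal.subset_span (Or.inl ⟨c, hc, rfl⟩))
    · rw [hz]
      exact Ideal.mul_mem_left _ _ (Ideal.subset_span (Or.inr ⟨c, hc, rfl⟩))
  · simp
  · intro x y _ _ hx hy
    rw [add_mul]; exact add_mem hx hy
  · intro g x _ hx
    rw [smul_eq_mul, mul_assoc]; exact Ideal.mul_mem_left _ _ hx

/-- The data for the regularity argument: `z 0, …, z (m - 1)` are central, the `ν a` anticommute,
`pr0` and `pr1` extract the components of degree `0` and `1`, and `ν 0, …, ν (r - 1)` satisfy the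
exactness condition `torsion` away from the origin. -/
structure RegularityData (ν z : ℕ → X) (r m : ℕ) (pr0 pr1 : X →+ X) : Prop where
  central : ∀ c x, z c * x = x * z c
  anticomm : ∀ a b, ν a * ν b = -(ν b * ν a)
  sq_zero : ∀ a, ν a * ν a = 0
  pr0_pr0 : ∀ x, pr0 (pr0 x) = pr0 x
  pr0_mul_z : ∀ x c, pr0 (x * z c) = 0
  pr0_mul_ν : ∀ x a, pr0 (x * ν a) = 0
  pr1_mul_z : ∀ x c, pr1 (x * z c) = pr0 x * z c
  pr1_mul_ν : ∀ x a, pr1 (x * ν a) = pr0 x * ν a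
  mem_of_pr0 : ∀ x, pr0 x = 0 → x ∈ truncIdeal ν z 0 m
  regular : ∀ b < m, ∀ x, x * z b ∈ truncIdeal ν z 0 b → x ∈ truncIdeal ν z 0 b
  torsion : ∀ i < r, ∀ b < m, ∀ x, x * ν i ∈ truncIdeal ν z i b →
    ∃ E : ℕ, x * z b ^ E ∈ truncIdeal ν z (i + 1) b

namespace RegularityData

variable {r m : ℕ} {pr0 pr1 : X →+ X} (h : RegularityData ν z r m pr0 pr1)
include h

theorem pr1_mem {i b : ℕ} {x : X} (hx : x ∈ truncIdeal ν z i b) : pr1 x ∈ truncIdeal ν z i b := by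
  induction i generalizing x with
  | zero =>
    induction b generalizing x with
    | zero =>
      rw [truncIdeal_zero] at hx ⊢
      rw [(Submodule.mem_bot _).1 hx, map_zero]; exact zero_mem _
    | succ b ih =>
      obtain ⟨g, y, hy, rfl⟩ := mem_truncIdeal_succ_right.1 hx
      rw [map_add, h.pr1_mul_z]
      exact mem_truncIdeal_succ_right.2 ⟨_, _, ih hy, rfl⟩
  | succ i ih =>
    obtain ⟨g, y, hy, rfl⟩ := mem_truncIdeal_succ_left.1 hx
    rw [map_add, h.pr1_mul_ν]
    exact mem_truncIdeal_succ_left.2 ⟨_, _, ih hy, rfl⟩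

/-- The factors `z b` cancel one at a time, because the intermediate products `x * z b ^ E` still
have no component of degree `0`. -/
theorem mem_of_mul_z_pow {i b : ℕ}
    (hP : ∀ x, pr0 x = 0 → x * z b ∈ truncIdeal ν z i b → x ∈ truncIdeal ν z i b) (E : ℕ) (x : X)
    (hx : pr0 x = 0) (hE : x * z b ^ E ∈ truncIdeal ν z i b) : x ∈ truncIdeal ν z i b := by
  induction E with
  | zero => simpa using hE
  | succ E ih =>
    refine ih (hP _ ?_ (by rwa [mul_assoc, ← pow_succ]))
    cases E with
    | zero => simpa using hx
    | succ E => rw [pow_succ, ← mul_assoc, h.pr0_mul_z]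

/-- In positive degrees, `z b` is regular modulo `truncIdeal ν z i b`, and `ν i` is regular on the
quotient by `truncIdeal ν z (i + 1) b`. -/
theorem regular_pair (i : ℕ) :
    (i ≤ r → ∀ b < m, ∀ x, pr0 x = 0 → x * z b ∈ truncIdeal ν z i b → x ∈ truncIdeal ν z i b) ∧
    (i < r → ∀ b ≤ m, ∀ x, pr0 x = 0 → x * ν i ∈ truncIdeal ν z i b →
      x ∈ truncIdeal ν z (i + 1) b) := by
  -- the first statement for `i + 1` and the second for `i` follow from the first for `i`
  have step : ∀ i < r,
      (∀ b < m, ∀ x, pr0 x = 0 → x * z b ∈ truncIdeal ν z i b → x ∈ truncIdeal ν z i b) →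
      ∀ d b, b + d = m →
        (b < m → ∀ x, pr0 x = 0 → x * z b ∈ truncIdeal ν z (i + 1) b →
          x ∈ truncIdeal ν z (i + 1) b) ∧
        (∀ x, pr0 x = 0 → x * ν i ∈ truncIdeal ν z i b → x ∈ truncIdeal ν z (i + 1) b) := by
    intro i hi hP d
    induction d with
    | zero =>
      intro b hb
      refine ⟨fun hb' => by omega, fun x hx _ => ?_⟩
      -- The descending induction on `b` starts where all the `z`'s are in the ideal, which then
      -- contains everything of positive degree.
      obtain rfl : b = m := by omega
      have := h.mem_of_pr0 x hx
      refine Ideal.span_mono ?_ this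
      simp
    | succ d ih =>
      intro b hb
      have hbm : b < m := by omega
      have P : ∀ x, pr0 x = 0 → x * z b ∈ truncIdeal ν z (i + 1) b →
          x ∈ truncIdeal ν z (i + 1) b := by
        intro x hx hxz
        obtain ⟨g, y, hy, hxy⟩ := mem_truncIdeal_succ_left.1 hxz
        -- The induction hypothesis does not apply to the constant term of `g`. Since `pr0 x = 0`,
        -- comparing components of degree `1` shows that this term contributes an element of
        -- `truncIdeal ν z i b`, so it can be split off.
        have h1 : pr0 g * ν i ∈ truncIdeal ν z i b := by
          have := congrArg pr1 hxy
          rw [h.pr1_mul_z, hx, zero_mul, map_add, h.pr1_mul_ν] at this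
          rw [eq_neg_of_add_eq_zero_left this.symm]
          exact neg_mem (h.pr1_mem hy)
        set g' := g - pr0 g with hg'
        have hg0 : pr0 g' = 0 := by rw [hg', map_sub, h.pr0_pr0, sub_self]
        have hxy' : x * z b = g' * ν i + (pr0 g * ν i + y) := by
          rw [hxy, hg', sub_mul]; abel
        have hy' := add_mem h1 hy
        have h2 : g' * ν i ∈ truncIdeal ν z i (b + 1) :=
          mem_truncIdeal_succ_right.2 ⟨x, -(pr0 g * ν i + y), neg_mem hy', by rw [hxy']; abel⟩
        -- The second statement for `b + 1` gives `g' = p z_b + p' ν_i + q'`. Multiplication by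
        -- `ν_i` kills the middle term, so `(x - p ν_i) z_b` falls into `truncIdeal ν z i b`, where
        -- `hP` applies.
        obtain ⟨p, q, hq, hpq⟩ := mem_truncIdeal_succ_right.1 ((ih (b + 1) (by omega)).2 g' hg0 h2)
        obtain ⟨p', q', hq', rfl⟩ := mem_truncIdeal_succ_left.1 hq
        have h3 : (x - p * ν i) * z b ∈ truncIdeal ν z i b := by
          have : (x - p * ν i) * z b = q' * ν i + (pr0 g * ν i + y) := by
            rw [sub_mul, hxy', hpq, add_mul, add_mul, mul_assoc p' _ _, h.sq_zero, mul_zero, zero_add,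
              mul_assoc p (z b), h.central, ← mul_assoc p]
            abel
          rw [this]
          exact add_mem (truncIdeal_mul_mem h.central h.anticomm hq' i) hy'
        have h4 := hP b hbm _ (by rw [map_sub, hx, h.pr0_mul_ν, sub_zero]) h3
        exact mem_truncIdeal_succ_left.2 ⟨p, _, h4, by abel⟩
      -- `torsion` gives the claim up to a power of `z b`, and `P` cancels that power.
      refine ⟨fun _ => P, fun x hx hxν => ?_⟩
      obtain ⟨E, hE⟩ := h.torsion i hi b hbm x hxν
      exact h.mem_of_mul_z_pow P E x hx hE
  have P : ∀ i ≤ r, ∀ b < m, ∀ x, pr0 x = 0 → x * z b ∈ truncIdeal ν z i b →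
      x ∈ truncIdeal ν z i b := by
    intro i
    induction i with
    | zero => exact fun _ b hb x _ hx => h.regular b hb x hx
    | succ i ih =>
      exact fun hi b hb => (step i hi (ih (by omega)) (m - b) b (by omega)).1 hb
  exact ⟨P i, fun hi b hb => (step i hi (P i hi.le) (m - b) b (by omega)).2⟩

end RegularityData

variable (ν) in
/-- The product `ν (r - 1) * ⋯ * ν 0`. -/
def descProd : ℕ → X
  | 0 => 1
  | i + 1 => ν i * descProd i

/-- In positive degrees, whatever is annihilated by `ν (r - 1) * ⋯ * ν 0` lies in the left ideal
generated by `ν 0, …, ν (r - 1)`. -/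
theorem RegularityData.mem_of_mul_descProd {r m : ℕ} {pr0 pr1 : X →+ X}
    (h : RegularityData ν z r m pr0 pr1) {i : ℕ} (hi : i ≤ r) {x : X} (hx : pr0 x = 0)
    (hxν : x * descProd ν i = 0) : x ∈ truncIdeal ν z i 0 := by
  induction i generalizing x with
  | zero =>
    rw [descProd, mul_one] at hxν
    rw [hxν]; exact zero_mem _
  | succ i ih =>
    refine (h.regular_pair i).2 hi 0 (Nat.zero_le _) x hx (ih (by omega) (h.pr0_mul_ν x i) ?_)
    rwa [mul_assoc]

end Regularity

/-! ### Matrices of linear forms without degenerate points -/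

section Nullstellensatz

open MvPolynomial

variable {Ω : Type*} [Field Ω] {m r N : ℕ}

/-- The linear form `∑ l, d l * X l`. -/
def linForm (d : Fin m → Ω) : MvPolynomial (Fin m) Ω := ∑ l, C (d l) * X l

theorem eval_linForm (d u : Fin m → Ω) : aeval u (linForm d) = ∑ l, d l * u l := by
  simp [linForm]

/-- By the Nullstellensatz: the polynomials that some `w` pairs to with column `a`, while pairing to
zero with the other columns, form an ideal `D`. Away from the origin the columns are independent, so
`D` has no zero there and its radical contains every variable. -/
theorem exists_dual_vector [IsAlgClosed Ω] (d : Fin r → Fin N → Fin m → Ω)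
    (hd : ∀ u : Fin m → Ω, u ≠ 0 → ∀ s : Fin r → Ω,
      (∀ i, ∑ a, s a * ∑ l, d a i l * u l = 0) → s = 0) (a : Fin r) (l : Fin m) :
    ∃ (E : ℕ) (w : Fin N → MvPolynomial (Fin m) Ω), ∀ a',
      ∑ i, w i * linForm (d a' i) = if a' = a then X l ^ E else 0 := by
  let D : Ideal (MvPolynomial (Fin m) Ω) :=
    { carrier := {p | ∃ w : Fin N → MvPolynomial (Fin m) Ω, ∀ a',
        ∑ i, w i * linForm (d a' i) = if a' = a then p else 0}
      zero_mem' := ⟨0, fun a' => by simp⟩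
      add_mem' := by
        rintro p q ⟨w, hw⟩ ⟨w', hw'⟩
        refine ⟨w + w', fun a' => ?_⟩
        simp only [Pi.add_apply, add_mul, Finset.sum_add_distrib, hw, hw']
        split_ifs <;> simp
      smul_mem' := by
        rintro c p ⟨w, hw⟩
        refine ⟨c • w, fun a' => ?_⟩
        simp only [Pi.smul_apply, smul_eq_mul, mul_assoc, ← Finset.mul_sum, hw]
        split_ifs <;> simp }
  have hX : X l ∈ D.radical := by
    rw [← vanishingIdeal_zeroLocus_eq_radical (K := Ω)]
    intro u hu
    rw [aeval_X]
    by_contra hul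
    have hu0 : u ≠ 0 := fun h => hul (by rw [h]; rfl)
    let V : Matrix (Fin N) (Fin r) Ω := Matrix.of fun i a => ∑ l, d a i l * u l
    have hV : LinearMap.ker V.mulVecLin = ⊥ := by
      rw [LinearMap.ker_eq_bot']
      intro s hs
      refine hd u hu0 s fun i => ?_
      have := congrFun hs i
      simp only [Matrix.mulVecLin_apply, Matrix.mulVec, dotProduct, Pi.zero_apply] at this
      rw [← this]
      exact Finset.sum_congr rfl fun a _ => mul_comm _ _
    obtain ⟨g, hg⟩ := V.mulVecLin.exists_leftInverse_of_injective hV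
    let Pm : Matrix (Fin r) (Fin N) Ω := LinearMap.toMatrix' g
    have hP : Pm * V = 1 := by
      have := congrArg LinearMap.toMatrix' hg
      rwa [LinearMap.toMatrix'_comp, LinearMap.toMatrix'_id, ← Matrix.toLin'_apply',
        LinearMap.toMatrix'_toLin'] at this
    let F : Matrix (Fin N) (Fin r) (MvPolynomial (Fin m) Ω) := Matrix.of fun i a => linForm (d a i)
    let Q : Matrix (Fin r) (Fin N) (MvPolynomial (Fin m) Ω) := Pm.map C
    let A : Matrix (Fin r) (Fin r) (MvPolynomial (Fin m) Ω) := Q * F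
    -- `Pm` is a left inverse of the value of `F` at `u`. The adjugate of `Pm F` clears
    -- denominators, and the determinant takes the value `1` at `u`.
    have hdet : A.det ∈ D := by
      refine ⟨(A.adjugate * Q) a, fun a' => ?_⟩
      have : A.adjugate * Q * F = A.det • (1 : Matrix _ _ _) := by
        rw [Matrix.mul_assoc, Matrix.adjugate_mul]
      have := congrFun (congrFun this a) a'
      rw [Matrix.mul_apply] at this
      simp only [F, Matrix.of_apply] at this
      rw [this, Matrix.smul_apply, Matrix.one_apply]
      simp [eq_comm]
    have h1 : aeval u A.det = (1 : Ω) := by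
      rw [AlgHom.map_det]
      have : (aeval u).mapMatrix A = (1 : Matrix (Fin r) (Fin r) Ω) := by
        rw [← hP]
        change (Q * F).map (aeval u) = Pm * V
        rw [Matrix.map_mul]
        congr 1
        · ext; simp [Q]
        · ext i a; exact eval_linForm _ _
      rw [this, Matrix.det_one]
    have h0 := hu _ hdet
    rw [h1] at h0
    exact one_ne_zero h0
  obtain ⟨E, w, hw⟩ := hX
  exact ⟨E, w, hw⟩

end Nullstellensatz

/-! ### Contractions and regularity in `Ω[X] ⊗ E` -/

section Core

variable {k : Type*} [Field k] {n : ℕ}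

theorem prod_e_eq_zero (s : List (Fin (n + 1))) (hs : n + 1 < s.length) :
    (s.map (e k)).prod = 0 := by
  have h : (s.map (e k)).prod =
      ExteriorAlgebra.ιMulti k s.length (fun i => Pi.single (s.get i) (1 : k)) := by
    rw [ExteriorAlgebra.ιMulti_apply]
    congr 1
    conv_lhs => rw [← List.ofFn_get s]
    rw [List.map_ofFn]; rfl
  rw [h]
  refine AlternatingMap.map_eq_zero_of_not_injective _ _ fun hinj => ?_
  have : Function.Injective s.get := fun i j hij => hinj (by simp only [hij])
  have := Fintype.card_le_of_injective _ this
  simp at this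
  omega

/-- Contraction with the `s`-th coordinate. -/
def contr (s : Fin (n + 1)) : ExtAlg k n →ₗ[k] ExtAlg k n :=
  (CliffordAlgebra.contractRight (Q := (0 : QuadraticForm k (Fin (n + 1) → k)))).flip
    (LinearMap.proj s)

theorem contr_mul_e (s i : Fin (n + 1)) (y : ExtAlg k n) :
    contr s (y * e k i) = (if s = i then y else 0) - contr s y * e k i := by
  have := CliffordAlgebra.contractRight_mul_ι (Q := (0 : QuadraticForm k (Fin (n + 1) → k)))
    (d := LinearMap.proj s) (Pi.single i 1) y
  refine this.trans ?_
  congr 1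
  rw [LinearMap.proj_apply, Pi.single_apply]
  split_ifs <;> simp

open MvPolynomial Algebra.TensorProduct

variable {Ω : Type*} [Field Ω] [Algebra k Ω] {m r : ℕ}

variable (k n) in
/-- The variable `X c` in `Ω[X] ⊗ E`. -/
def zElt (Ω : Type*) [Field Ω] [Algebra k Ω] (m : ℕ) (c : ℕ) : MvPolynomial (Fin m) Ω ⊗[k] ExtAlg k n :=
  if h : c < m then (X ⟨c, h⟩) ⊗ₜ 1 else 0

/-- The element `∑ i, (∑ l, d a i l * X l) ⊗ e i` of `Ω[X] ⊗ E`. -/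
def νElt (d : Fin r → Fin (n + 1) → Fin m → Ω) (a : ℕ) : MvPolynomial (Fin m) Ω ⊗[k] ExtAlg k n :=
  if h : a < r then ∑ i, linForm (d ⟨a, h⟩ i) ⊗ₜ e k i else 0

theorem e_mul_e_swap (i j : Fin (n + 1)) : e k i * e k j = -(e k j * e k i) :=
  eq_neg_of_add_eq_zero_left (ExteriorAlgebra.ι_add_mul_swap _ _)

theorem e_mul_self (i : Fin (n + 1)) : e k i * e k i = 0 := ExteriorAlgebra.ι_sq_zero _

theorem νElt_anticomm (d : Fin r → Fin (n + 1) → Fin m → Ω) (a b : ℕ) :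
    (νElt d a : MvPolynomial (Fin m) Ω ⊗[k] ExtAlg k n) * νElt d b = -(νElt d b * νElt d a) := by
  unfold νElt
  split_ifs <;> try simp only [mul_zero, zero_mul, neg_zero]
  rw [Finset.sum_mul_sum, Finset.sum_mul_sum, Finset.sum_comm, ← Finset.sum_neg_distrib]
  refine Finset.sum_congr rfl fun i _ => ?_
  rw [← Finset.sum_neg_distrib]
  refine Finset.sum_congr rfl fun j _ => ?_
  rw [tmul_mul_tmul, tmul_mul_tmul, e_mul_e_swap, mul_comm, TensorProduct.tmul_neg]

theorem νElt_sq (d : Fin r → Fin (n + 1) → Fin m → Ω) (a : ℕ) :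
    (νElt d a : MvPolynomial (Fin m) Ω ⊗[k] ExtAlg k n) * νElt d a = 0 := by
  unfold νElt
  split_ifs <;> try simp only [mul_zero]
  rw [Finset.sum_mul_sum, ← Fintype.sum_prod_type']
  refine Finset.sum_involution (fun p _ => (p.2, p.1)) ?_ ?_ ?_ ?_
  · rintro ⟨i, j⟩ _
    rw [tmul_mul_tmul, tmul_mul_tmul, e_mul_e_swap, mul_comm, TensorProduct.tmul_neg]
    exact neg_add_cancel _
  · rintro ⟨i, j⟩ _ h0 h1
    obtain rfl : j = i := congrArg Prod.fst h1
    exact h0 (by rw [tmul_mul_tmul, e_mul_self, TensorProduct.tmul_zero])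
  · intro p _; exact Finset.mem_univ _
  · intro p _; rfl

theorem zElt_central (c : ℕ) (x : MvPolynomial (Fin m) Ω ⊗[k] ExtAlg k n) :
    zElt k n Ω m c * x = x * zElt k n Ω m c := by
  unfold zElt
  split_ifs with h
  · exact Algebra.commutes (R := MvPolynomial (Fin m) Ω) (X ⟨c, h⟩) x
  · simp

theorem mul_zElt_pow (c : Fin m) (E : ℕ) (x : MvPolynomial (Fin m) Ω ⊗[k] ExtAlg k n) :
    x * zElt k n Ω m c ^ E = (X c ^ E : MvPolynomial (Fin m) Ω) • x := by
  have : zElt k n Ω m c = algebraMap (MvPolynomial (Fin m) Ω) _ (X c) := by simp [zElt]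
  rw [this, ← map_pow, ← Algebra.commutes]
  exact (Algebra.smul_def _ _).symm

/-- The component of degree `q` with respect to the polynomial variables. -/
def degComp (q : ℕ) :
    MvPolynomial (Fin m) Ω ⊗[k] ExtAlg k n →ₗ[k] MvPolynomial (Fin m) Ω ⊗[k] ExtAlg k n :=
  TensorProduct.map ((homogeneousComponent q).restrictScalars k) LinearMap.id

theorem linForm_isHomogeneous (d : Fin m → Ω) : (linForm d).IsHomogeneous 1 :=
  IsHomogeneous.sum _ _ _ fun l _ => by
    simpa using (isHomogeneous_C (Fin m) (d l)).mul (isHomogeneous_X Ω l)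

theorem homogeneousComponent_mul_of_one {p q : MvPolynomial (Fin m) Ω} (hq : q.IsHomogeneous 1)
    (a : ℕ) : homogeneousComponent (a + 1) (p * q) = homogeneousComponent a p * q := by
  have h (i : ℕ) : homogeneousComponent (a + 1) (homogeneousComponent i p * q) =
      if i = a then homogeneousComponent a p * q else 0 := by
    rw [homogeneousComponent_of_mem ((homogeneousComponent_isHomogeneous i p).mul hq)]
    by_cases hi : i = a
    · simp [hi]
    · rw [if_neg (by omega), if_neg hi]
  conv_lhs => rw [← sum_homogeneousComponent p]
  rw [Finset.sum_mul, map_sum]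
  simp only [h, Finset.sum_ite_eq', Finset.mem_range]
  split_ifs with ha
  · rfl
  · rw [homogeneousComponent_eq_zero _ _ (by omega), zero_mul]

theorem homogeneousComponent_zero_mul_of_one {p q : MvPolynomial (Fin m) Ω} (hq : q.IsHomogeneous 1) :
    homogeneousComponent 0 (p * q) = 0 := by
  have h (i : ℕ) : homogeneousComponent 0 (homogeneousComponent i p * q) = 0 := by
    rw [homogeneousComponent_of_mem ((homogeneousComponent_isHomogeneous i p).mul hq)]
    exact if_neg (by omega)
  rw [← sum_homogeneousComponent p, Finset.sum_mul, map_sum]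
  exact Finset.sum_eq_zero fun i _ => h i

theorem degComp_zero_mul {p : MvPolynomial (Fin m) Ω} (hp : p.IsHomogeneous 1) (y : ExtAlg k n)
    (x : MvPolynomial (Fin m) Ω ⊗[k] ExtAlg k n) : degComp 0 (x * p ⊗ₜ y) = 0 := by
  induction x using TensorProduct.induction_on with
  | zero => simp
  | add x x' h h' => rw [add_mul, map_add, h, h', add_zero]
  | tmul c y' =>
    rw [tmul_mul_tmul, degComp, TensorProduct.map_tmul, LinearMap.restrictScalars_apply,
      homogeneousComponent_zero_mul_of_one hp, TensorProduct.zero_tmul]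

theorem degComp_one_mul {p : MvPolynomial (Fin m) Ω} (hp : p.IsHomogeneous 1) (y : ExtAlg k n)
    (x : MvPolynomial (Fin m) Ω ⊗[k] ExtAlg k n) :
    degComp 1 (x * p ⊗ₜ y) = degComp 0 x * p ⊗ₜ y := by
  induction x using TensorProduct.induction_on with
  | zero => simp
  | add x x' h h' => rw [add_mul, map_add, h, h', map_add, add_mul]
  | tmul c y' =>
    rw [tmul_mul_tmul, degComp, degComp, TensorProduct.map_tmul, TensorProduct.map_tmul,
      LinearMap.restrictScalars_apply, LinearMap.restrictScalars_apply, tmul_mul_tmul,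
      ← homogeneousComponent_mul_of_one hp]; rfl

/-- Contraction with the vector `w` of polynomials. -/
def polyContr (w : Fin (n + 1) → MvPolynomial (Fin m) Ω) :
    MvPolynomial (Fin m) Ω ⊗[k] ExtAlg k n →ₗ[MvPolynomial (Fin m) Ω]
      MvPolynomial (Fin m) Ω ⊗[k] ExtAlg k n :=
  ∑ s, w s • (contr s).baseChange (MvPolynomial (Fin m) Ω)

theorem polyContr_mul (w : Fin (n + 1) → MvPolynomial (Fin m) Ω) (p : MvPolynomial (Fin m) Ω)
    (i : Fin (n + 1)) (x : MvPolynomial (Fin m) Ω ⊗[k] ExtAlg k n) :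
    polyContr w (x * p ⊗ₜ e k i) = (w i * p) • x - polyContr w x * p ⊗ₜ e k i := by
  induction x using TensorProduct.induction_on with
  | zero => simp
  | add x x' h h' => rw [add_mul, map_add, h, h', map_add, add_mul, smul_add]; abel
  | tmul c y =>
    simp only [polyContr, LinearMap.sum_apply, LinearMap.smul_apply, LinearMap.baseChange_tmul,
      tmul_mul_tmul, contr_mul_e, TensorProduct.tmul_sub, smul_sub, Finset.sum_sub_distrib,
      Finset.sum_mul, smul_mul_assoc]
    congr 1
    rw [Finset.sum_eq_single i]
    · rw [if_pos rfl, TensorProduct.smul_tmul', TensorProduct.smul_tmul', smul_eq_mul, smul_eq_mul]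
      congr 1; ring
    · intro s _ hs
      rw [if_neg hs, TensorProduct.tmul_zero, smul_zero]
    · simp

theorem polyContr_mul_νElt (w : Fin (n + 1) → MvPolynomial (Fin m) Ω)
    (d : Fin r → Fin (n + 1) → Fin m → Ω) (a : Fin r)
    (x : MvPolynomial (Fin m) Ω ⊗[k] ExtAlg k n) :
    polyContr w (x * νElt d a) =
      (∑ i, w i * linForm (d a i)) • x - polyContr w x * νElt d a := by
  simp only [νElt, a.2, dite_true, Finset.mul_sum, map_sum, polyContr_mul, Finset.sum_sub_distrib,
    Finset.sum_smul]

variable (k n Ω m) in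
/-- The substitution that kills the first `b` polynomial variables. -/
def killVars (b : ℕ) : MvPolynomial (Fin m) Ω ⊗[k] ExtAlg k n →ₐ[k] MvPolynomial (Fin m) Ω ⊗[k] ExtAlg k n :=
  Algebra.TensorProduct.map
    ((aeval fun c : Fin m => if (c : ℕ) < b then 0 else X c : MvPolynomial (Fin m) Ω →ₐ[Ω] _).restrictScalars k)
    (AlgHom.id k _)

theorem zElt_mem (ν : ℕ → MvPolynomial (Fin m) Ω ⊗[k] ExtAlg k n) {i b : ℕ} {c : ℕ} (hc : c < b) :
    zElt k n Ω m c ∈ truncIdeal ν (zElt k n Ω m) i b :=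
  Ideal.subset_span (Or.inr ⟨c, hc, rfl⟩)

/-- With `killVars_eq_zero_of_mem`, this identifies `truncIdeal ν z 0 b` with the kernel of the
substitution, which reduces regularity of `z b` to the polynomial ring being a domain. -/
theorem sub_killVars_mem (ν : ℕ → MvPolynomial (Fin m) Ω ⊗[k] ExtAlg k n) (b : ℕ)
    (x : MvPolynomial (Fin m) Ω ⊗[k] ExtAlg k n) :
    x - killVars k n Ω m b x ∈ truncIdeal ν (zElt k n Ω m) 0 b := by
  induction x using TensorProduct.induction_on with
  | zero => simp
  | add x x' h h' =>
    rw [map_add, add_sub_add_comm]; exact add_mem h h'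
  | tmul p y =>
    rw [killVars, Algebra.TensorProduct.map_tmul, AlgHom.restrictScalars_apply, AlgHom.id_apply,
      ← TensorProduct.sub_tmul]
    set σ : MvPolynomial (Fin m) Ω →ₐ[Ω] MvPolynomial (Fin m) Ω :=
      aeval fun c : Fin m => if (c : ℕ) < b then 0 else X c
    have key : ∀ p : MvPolynomial (Fin m) Ω, (p - σ p) ⊗ₜ[k] (1 : ExtAlg k n) ∈
        truncIdeal ν (zElt k n Ω m) 0 b := by
      intro p
      induction p using MvPolynomial.induction_on with
      | C r => simp [σ]
      | add p q hp hq =>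
        rw [map_add, add_sub_add_comm, TensorProduct.add_tmul]; exact add_mem hp hq
      | mul_X p c hp =>
        have h1 : (p * X c - σ (p * X c)) = X c * (p - σ p) + σ p * (X c - σ (X c)) := by
          rw [map_mul]; ring
        have h2 : (X c - σ (X c)) ⊗ₜ[k] (1 : ExtAlg k n) ∈ truncIdeal ν (zElt k n Ω m) 0 b := by
          by_cases hc : (c : ℕ) < b
          · have := zElt_mem (k := k) (n := n) (Ω := Ω) (m := m) ν (i := 0) hc
            simpa [σ, hc, zElt] using this
          · simp [σ, hc]
        rw [h1, TensorProduct.add_tmul]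
        refine add_mem ?_ ?_
        · have := Ideal.mul_mem_left _ (X c ⊗ₜ[k] (1 : ExtAlg k n)) hp
          rwa [tmul_mul_tmul, one_mul] at this
        · have := Ideal.mul_mem_left _ (σ p ⊗ₜ[k] (1 : ExtAlg k n)) h2
          rwa [tmul_mul_tmul, one_mul] at this
    have := Ideal.mul_mem_left _ (1 ⊗ₜ[k] y) (key p)
    rwa [tmul_mul_tmul, one_mul, mul_one] at this

theorem killVars_eq_zero_of_mem (ν : ℕ → MvPolynomial (Fin m) Ω ⊗[k] ExtAlg k n) {b : ℕ}
    {x : MvPolynomial (Fin m) Ω ⊗[k] ExtAlg k n} (hx : x ∈ truncIdeal ν (zElt k n Ω m) 0 b) :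
    killVars k n Ω m b x = 0 := by
  refine Submodule.span_induction ?_ ?_ ?_ ?_ hx
  · rintro _ (⟨c, hc, rfl⟩ | ⟨c, hc, rfl⟩)
    · simp at hc
    · have hc : c < b := hc
      unfold zElt
      split_ifs
      · simp [killVars, hc]
      · simp
  · simp
  · intro x y _ _ h h'; rw [map_add, h, h', add_zero]
  · intro a x _ h; rw [smul_eq_mul, map_mul, h, mul_zero]

theorem killVars_zElt {b : ℕ} (hb : b < m) : killVars k n Ω m b (zElt k n Ω m b) = zElt k n Ω m b := by
  simp [killVars, zElt, hb]

theorem killVars_eq_degComp : (killVars k n Ω m m).toLinearMap = degComp 0 := by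
  refine TensorProduct.ext' fun p y => ?_
  have : (aeval fun c : Fin m => if (c : ℕ) < m then 0 else X c :
      MvPolynomial (Fin m) Ω →ₐ[Ω] MvPolynomial (Fin m) Ω) p = homogeneousComponent 0 p := by
    rw [homogeneousComponent_zero, ← constantCoeff_eq]
    have : (fun c : Fin m => if (c : ℕ) < m then (0 : MvPolynomial (Fin m) Ω) else X c) = 0 := by
      ext1 c; simp
    rw [this, aeval_zero]; rfl
  rw [AlgHom.toLinearMap_apply, killVars, Algebra.TensorProduct.map_tmul,
    AlgHom.restrictScalars_apply, this]; rfl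

/-- Contraction is an antiderivation up to sign, linear over the polynomials. It therefore preserves
the ideal once `w` pairs to zero with the `ν`'s among the generators. -/
theorem polyContr_mem (w : Fin (n + 1) → MvPolynomial (Fin m) Ω)
    (d : Fin r → Fin (n + 1) → Fin m → Ω) {i b : ℕ} (hi : i ≤ r)
    (hw : ∀ a : Fin r, (a : ℕ) < i → ∑ s, w s * linForm (d a s) = 0)
    {x : MvPolynomial (Fin m) Ω ⊗[k] ExtAlg k n}
    (hx : x ∈ truncIdeal (νElt d) (zElt k n Ω m) i b) :
    polyContr w x ∈ truncIdeal (νElt d) (zElt k n Ω m) i b := by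
  induction i generalizing x with
  | zero =>
    induction b generalizing x with
    | zero =>
      rw [truncIdeal_zero] at hx ⊢
      rw [(Submodule.mem_bot _).1 hx, map_zero]; exact zero_mem _
    | succ b ih =>
      obtain ⟨g, y, hy, rfl⟩ := mem_truncIdeal_succ_right.1 hx
      refine mem_truncIdeal_succ_right.2 ⟨polyContr w g, _, ih hy, ?_⟩
      rw [map_add]
      congr 1
      by_cases hb : b < m
      · have := mul_zElt_pow (k := k) (n := n) (⟨b, hb⟩ : Fin m) 1 g
        have h' := mul_zElt_pow (k := k) (n := n) (⟨b, hb⟩ : Fin m) 1 (polyContr w g)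
        rw [pow_one] at this h'
        rw [this, h', map_smul]
      · simp [zElt, hb]
  | succ i ih =>
    obtain ⟨g, y, hy, rfl⟩ := mem_truncIdeal_succ_left.1 hx
    refine mem_truncIdeal_succ_left.2 ⟨-polyContr w g, _,
      ih (by omega) (fun a ha => hw a (by omega)) hy, ?_⟩
    rw [map_add]
    congr 1
    have := polyContr_mul_νElt w d ⟨i, by omega⟩ g
    rw [hw _ (by simp), zero_smul, zero_sub] at this
    exact this.trans (neg_mul (polyContr w g) _).symm

theorem regularityData [IsAlgClosed Ω] (d : Fin r → Fin (n + 1) → Fin m → Ω)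
    (hd : ∀ u : Fin m → Ω, u ≠ 0 → ∀ s : Fin r → Ω,
      (∀ i, ∑ a, s a * ∑ l, d a i l * u l = 0) → s = 0) :
    RegularityData (νElt d) (zElt k n Ω m) r m (degComp 0).toAddMonoidHom
      (degComp 1).toAddMonoidHom where
  central := zElt_central
  anticomm := νElt_anticomm d
  sq_zero := νElt_sq d
  pr0_pr0 x := by
    change degComp 0 (degComp 0 x) = degComp 0 x
    induction x using TensorProduct.induction_on with
    | zero => simp
    | add x x' h h' => rw [map_add, map_add, h, h']
    | tmul c y => simp [degComp]
  pr0_mul_z x c := by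
    change degComp 0 _ = 0
    unfold zElt
    split_ifs
    · exact degComp_zero_mul (isHomogeneous_X _ _) _ _
    · simp
  pr0_mul_ν x a := by
    change degComp 0 _ = 0
    unfold νElt
    split_ifs
    · rw [Finset.mul_sum, map_sum]
      exact Finset.sum_eq_zero fun i _ => degComp_zero_mul (linForm_isHomogeneous _) _ _
    · simp
  pr1_mul_z x c := by
    change degComp 1 _ = degComp 0 x * _
    unfold zElt
    split_ifs
    · exact degComp_one_mul (isHomogeneous_X _ _) _ _
    · simp
  pr1_mul_ν x a := by
    change degComp 1 _ = degComp 0 x * _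
    unfold νElt
    split_ifs
    · rw [Finset.mul_sum, map_sum, Finset.mul_sum]
      exact Finset.sum_congr rfl fun i _ => degComp_one_mul (linForm_isHomogeneous _) _ _
    · simp
  mem_of_pr0 x hx := by
    have h := sub_killVars_mem (νElt d) m x
    have h2 : killVars k n Ω m m x = degComp 0 x := LinearMap.congr_fun killVars_eq_degComp x
    have h3 : degComp 0 x = 0 := hx
    rwa [h2, h3, sub_zero] at h
  regular b hb x hx := by
    have h := killVars_eq_zero_of_mem _ hx
    rw [map_mul, killVars_zElt hb] at h
    have h1 := mul_zElt_pow (k := k) (n := n) (⟨b, hb⟩ : Fin m) 1 (killVars k n Ω m b x)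
    rw [pow_one, h, pow_one] at h1
    have h2 : killVars k n Ω m b x = 0 :=
      (smul_eq_zero.1 h1.symm).resolve_left (X_ne_zero _)
    have := sub_killVars_mem (νElt d) b x
    rwa [h2, sub_zero] at this
  torsion i hi b hb x hx := by
    -- Contract `x ν_i` with a `w` pairing to `X_b ^ E` with `ν_i` and to zero with the earlier
    -- `ν`'s. The result is `X_b ^ E x` minus a multiple of `ν_i`, and it stays in `truncIdeal` for
    -- `i` and `b`.
    obtain ⟨E, w, hw⟩ := exists_dual_vector d hd ⟨i, hi⟩ ⟨b, hb⟩
    refine ⟨E, ?_⟩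
    have h := polyContr_mem w d hi.le
      (fun a ha => by rw [hw, if_neg]; rintro rfl; exact lt_irrefl _ ha) hx
    have h1 := polyContr_mul_νElt w d ⟨i, hi⟩ x
    rw [hw, if_pos rfl] at h1
    rw [mul_zElt_pow (⟨b, hb⟩ : Fin m)]
    refine mem_truncIdeal_succ_left.2 ⟨polyContr w x, _, h, ?_⟩
    rw [← sub_eq_iff_eq_add', ← h1]

/-- Each `ν` contributes one exterior variable, so every term of the expansion has more than `n + 1`
of them. -/
theorem mul_descProd_eq_zero (d : Fin r → Fin (n + 1) → Fin m → Ω) (i : ℕ)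
    (p : MvPolynomial (Fin m) Ω) (s : List (Fin (n + 1))) (hs : n + 1 < i + s.length) :
    (p ⊗ₜ[k] (s.map (e k)).prod : MvPolynomial (Fin m) Ω ⊗[k] ExtAlg k n) * descProd (νElt (k := k) d) i = 0 := by
  induction i generalizing p s with
  | zero =>
    rw [prod_e_eq_zero s (by omega), TensorProduct.tmul_zero, zero_mul]
  | succ i ih =>
    rw [descProd, ← mul_assoc]
    by_cases hi : i < r
    · simp only [νElt, hi, dite_true, Finset.mul_sum, Finset.sum_mul, tmul_mul_tmul]
      refine Finset.sum_eq_zero fun j _ => ?_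
      have := ih (p * linForm (d ⟨i, hi⟩ j)) (s ++ [j]) (by simp; omega)
      simpa using this
    · simp [νElt, hi]

/-- The functional `p ⊗ y ↦ ∑ l, (coefficient of X l in p) * f l y`. -/
def linPairing (f : Fin m → ExtAlg k n →ₗ[k] k) : MvPolynomial (Fin m) Ω ⊗[k] ExtAlg k n →ₗ[k] Ω :=
  ∑ l, TensorProduct.lift ((LinearMap.mul k Ω).compl₁₂
    ((MvPolynomial.lcoeff Ω (Finsupp.single l 1)).restrictScalars k) (Algebra.linearMap k Ω ∘ₗ f l))

theorem linPairing_tmul (f : Fin m → ExtAlg k n →ₗ[k] k) (p : MvPolynomial (Fin m) Ω)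
    (y : ExtAlg k n) : linPairing f (p ⊗ₜ y) =
      ∑ l, coeff (Finsupp.single l 1) p * algebraMap k Ω (f l y) := by
  simp [linPairing, LinearMap.sum_apply]

theorem coeff_mul_linForm (p : MvPolynomial (Fin m) Ω) (d : Fin m → Ω) (l : Fin m) :
    coeff (Finsupp.single l 1) (p * linForm d) = coeff 0 p * d l := by
  classical
  simp only [linForm, Finset.mul_sum, coeff_sum]
  rw [Finset.sum_eq_single l]
  · rw [← mul_assoc, coeff_mul_X']
    simp [mul_comm p, mul_comm (d l)]
  · intro l' _ hl
    rw [← mul_assoc, coeff_mul_X', if_neg]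
    simpa using fun h => hl h
  · simp

/-- A family of functionals that annihilates the left ideal generated by a family of elements of
`E_1 ⊗ Ω ^ m` without degenerate points vanishes on products of `j` exterior variables, as soon as
`j > n + 1 - r`. -/
theorem functional_eq_zero [IsAlgClosed Ω] (d : Fin r → Fin (n + 1) → Fin m → Ω)
    (hd : ∀ u : Fin m → Ω, u ≠ 0 → ∀ s : Fin r → Ω,
      (∀ i, ∑ a, s a * ∑ l, d a i l * u l = 0) → s = 0)
    (f : Fin m → ExtAlg k n →ₗ[k] k)
    (hf : ∀ a y, ∑ i, ∑ l, d a i l * algebraMap k Ω (f l (y * e k i)) = 0)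
    (s : List (Fin (n + 1))) (hs : n + 1 < r + s.length) (l : Fin m) :
    f l (s.map (e k)).prod = 0 := by
  set Y := (s.map (e k)).prod with hY
  -- The factor `X l` supplies the positive degree that `mem_of_mul_descProd` requires.
  have h1 : (X l : MvPolynomial (Fin m) Ω) ⊗ₜ[k] Y ∈ truncIdeal (νElt d) (zElt k n Ω m) r 0 := by
    refine (regularityData d hd).mem_of_mul_descProd le_rfl ?_ (mul_descProd_eq_zero d r _ s hs)
    have := degComp_zero_mul (isHomogeneous_X Ω l) Y (1 : MvPolynomial (Fin m) Ω ⊗[k] ExtAlg k n)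
    rwa [one_mul] at this
  have h2 : ∀ x ∈ truncIdeal (νElt d) (zElt k n Ω m) r 0, linPairing f x = 0 := by
    intro x hx
    -- The pairing is not linear over the ring, so the induction carries all left multiples of `x`.
    refine Submodule.span_induction (p := fun x _ => ∀ g, linPairing f (g * x) = 0)
      ?_ ?_ ?_ ?_ hx 1 |> fun h => by rwa [one_mul] at h
    · rintro _ (⟨a, ha, rfl⟩ | ⟨c, hc, rfl⟩) g
      · have ha : a < r := ha
        induction g using TensorProduct.induction_on with
        | zero => simp
        | add g g' h h' => rw [add_mul, map_add, h, h', add_zero]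
        | tmul p y =>
          simp only [νElt, ha, dite_true, Finset.mul_sum, map_sum, tmul_mul_tmul, linPairing_tmul,
            coeff_mul_linForm, mul_assoc]
          rw [← mul_zero (coeff 0 p), ← hf ⟨a, ha⟩ y]
          simp only [Finset.mul_sum]
      · simp at hc
    · simp
    · intro x y _ _ hx hy g
      rw [mul_add, map_add, hx, hy, add_zero]
    · intro a x _ hx g
      rw [smul_eq_mul, ← mul_assoc]; exact hx _
  have h3 := h2 _ h1
  rw [linPairing_tmul, Finset.sum_eq_single l] at h3
  · simpa using h3
  · intro l' _ hl
    rw [coeff_X, if_neg, zero_mul]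
    simpa [Finsupp.single_left_inj] using fun h => hl h.symm
  · simp

end Core

/-! ### Transcendence degree and dimension -/

section Transcendence

variable {k Ω : Type*} [Field k] [Field Ω] [Algebra k Ω]

/-- The elements of `Ω` that are algebraic over the subalgebra generated by `T`. -/
def relClosure (k : Type*) {Ω : Type*} [Field k] [Field Ω] [Algebra k Ω] (T : Set Ω) :
    IntermediateField k Ω :=
  { (Subalgebra.algebraicClosure (Algebra.adjoin k T) Ω).restrictScalars k with
    inv_mem' := fun _ h => IsAlgebraic.inv_iff.2 h }

theorem subset_relClosure (T : Set Ω) : T ⊆ relClosure k T := fun a ha =>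
  isAlgebraic_algebraMap (⟨a, Algebra.subset_adjoin ha⟩ : Algebra.adjoin k T)

theorem relClosure_le {S T : Set Ω} (h : S ⊆ relClosure k T) : relClosure k S ≤ relClosure k T :=
  fun _ ha => IsAlgebraic.adjoin_of_forall_isAlgebraic (fun _ hx => h hx.1) ha

/-- This is the rank inequality in the matroid of algebraic independence. -/
theorem card_le_of_mem_relClosure {σ τ : Type*} [Fintype σ] [Fintype τ] {x : σ → Ω}
    (hx : AlgebraicIndependent k x) (y : τ → Ω) (h : ∀ i, x i ∈ relClosure k (Set.range y)) :
    Fintype.card σ ≤ Fintype.card τ := by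
  have hI : (AlgebraicIndependent.matroid k Ω).Indep (Set.range x) :=
    AlgebraicIndependent.matroid_indep_iff.2 hx.to_subtype_range
  have hsub : Set.range x ⊆ (AlgebraicIndependent.matroid k Ω).closure (Set.range y) := by
    rw [AlgebraicIndependent.matroid_closure_eq]
    rintro _ ⟨i, rfl⟩
    exact h i
  have h1 := hI.encard_le_eRk_of_subset hsub
  rw [Matroid.eRk_closure_eq] at h1
  have h2 := h1.trans ((AlgebraicIndependent.matroid k Ω).eRk_le_encard _)
  rw [← Set.image_univ, ← Set.image_univ, hx.injective.encard_image] at h2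
  have h3 := h2.trans (Set.encard_image_le _ _)
  simpa [Set.encard_univ] using h3

/-- Going up lifts each chain of primes of the polynomial ring, starting from a prime of `R` over
the smallest one. -/
theorem natCast_le_ringKrullDim_of_isIntegral {d : ℕ} {R : Type*} [CommRing R]
    (g : MvPolynomial (Fin d) k →+* R) (hg : Function.Injective g) (hint : g.IsIntegral) :
    (d : WithBot ℕ∞) ≤ ringKrullDim R := by
  let := g.toAlgebra
  have : Algebra.IsIntegral (MvPolynomial (Fin d) k) R := ⟨hint⟩
  have hd : ringKrullDim (MvPolynomial (Fin d) k) = d := by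
    rw [MvPolynomial.ringKrullDim_of_isNoetherianRing, ringKrullDim_eq_zero_of_field]; simp
  rw [← hd]
  refine iSup_le fun l => ?_
  obtain ⟨Q, -, hQ, hQl⟩ := Ideal.exists_ideal_over_prime_of_isIntegral l.head.asIdeal (⊥ : Ideal R)
    (by
      rw [← RingHom.ker_eq_comap_bot]
      exact ((RingHom.injective_iff_ker_eq_bot g).1 hg).le.trans bot_le)
  have : Q.LiesOver l.head.asIdeal := ⟨hQl.symm⟩
  obtain ⟨L, hL, -⟩ := Ideal.exists_ltSeries_of_hasGoingUp l Q
  rw [← hL]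
  exact le_iSup (fun p : LTSeries (PrimeSpectrum R) => (p.length : WithBot ℕ∞)) L

/-- The dimension of the closure of a point with coordinates `z` bounds the number of elements that
are needed to make `z` algebraic. -/
theorem exists_algebraic_le_ringKrullDim {ι : Type*} [Finite ι] (z : ι → Ω) :
    ∃ (d : ℕ) (y : Fin d → Ω), (∀ i, z i ∈ relClosure k (Set.range y)) ∧ (d : WithBot ℕ∞) ≤
      ringKrullDim (MvPolynomial ι k ⧸ RingHom.ker (MvPolynomial.aeval z : MvPolynomial ι k →ₐ[k] Ω)) := by
  set φ : MvPolynomial ι k →ₐ[k] Ω := MvPolynomial.aeval z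
  have : (RingHom.ker φ).IsPrime := RingHom.ker_isPrime _
  -- Noether normalization of the coordinate ring of the closure of `z`; the `y`'s are the images in
  -- `Ω` of its parameters.
  obtain ⟨d, g, hg, hint⟩ := exists_integral_inj_algHom_of_fg k (MvPolynomial ι k ⧸ RingHom.ker φ)
  let ψ : (MvPolynomial ι k ⧸ RingHom.ker φ) →ₐ[k] Ω := Ideal.kerLiftAlg φ
  refine ⟨d, fun i => ψ (g (MvPolynomial.X i)), fun i => ?_,
    natCast_le_ringKrullDim_of_isIntegral g.toRingHom hg hint⟩
  have hz : z i = ψ (Ideal.Quotient.mk _ (MvPolynomial.X i)) := by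
    change z i = φ (MvPolynomial.X i)
    simp [φ]
  obtain ⟨P, hP, hP0⟩ := hint (Ideal.Quotient.mk _ (MvPolynomial.X i))
  have hmem : ∀ q : MvPolynomial (Fin d) k, ψ (g q) ∈
      Algebra.adjoin k (Set.range fun i => ψ (g (MvPolynomial.X i))) := by
    intro q
    have : (ψ.comp g) q ∈ (ψ.comp g).range := ⟨q, rfl⟩
    have h2 : ψ.comp g = MvPolynomial.aeval fun i => ψ (g (MvPolynomial.X i)) := by
      ext i; simp
    rw [h2, ← Algebra.adjoin_range_eq_range_aeval] at this
    rw [← h2] at this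
    exact this
  let G : MvPolynomial (Fin d) k →+*
      Algebra.adjoin k (Set.range fun i => ψ (g (MvPolynomial.X i))) :=
    (ψ.comp g).toRingHom.codRestrict (Algebra.adjoin k _).toSubring hmem
  refine IsIntegral.isAlgebraic ⟨P.map G, hP.map _, ?_⟩
  rw [hz, Polynomial.eval₂_map]
  have := congrArg ψ hP0
  rw [map_zero, ← AlgHom.coe_toRingHom, Polynomial.hom_eval₂] at this
  exact this

end Transcendence

/-! ### Linear systems over a subfield -/

section LinearSystem

variable {F Ω : Type*} [Field F] [Field Ω] [Algebra F Ω] {I J : Type*} [Fintype I] [Fintype J]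

/-- A maximal independent subfamily, with its complement. -/
theorem exists_maximal_independent {V : Type*} [AddCommGroup V] [Module F V] (v : I → V) :
    ∃ S : Finset I, S.card = Module.finrank F (Submodule.span F (Set.range v)) ∧
      LinearIndependent F (fun i : S => v i) ∧
      ∀ i, ∃ D : I → F, v i = ∑ s ∈ S, D s • v s := by
  obtain ⟨κ, a, ha, hspan, hli⟩ := exists_linearIndependent' F v
  have : Fintype κ := Fintype.ofInjective a ha
  refine ⟨Finset.univ.map ⟨a, ha⟩, ?_, ?_, fun i => ?_⟩
  · rw [Finset.card_map, Finset.card_univ, ← hspan, finrank_span_eq_card hli]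
  · let f : (Finset.univ.map ⟨a, ha⟩ : Finset I) → κ := fun i => (Finset.mem_map.1 i.2).choose
    have hf : ∀ i, a (f i) = i := fun i => (Finset.mem_map.1 i.2).choose_spec.2
    have hinj : Function.Injective f := fun i j hij => Subtype.ext (by rw [← hf i, hij, hf j])
    have := hli.comp f hinj
    convert this using 2 with i
    simp [hf]
  · have hi : v i ∈ Submodule.span F (Set.range (v ∘ a)) := by
      rw [hspan]; exact Submodule.subset_span ⟨i, rfl⟩
    obtain ⟨c, hc⟩ := (Submodule.mem_span_range_iff_exists_fun F).1 hi
    refine ⟨Function.extend a c 0, ?_⟩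
    rw [Finset.sum_map, ← hc]
    simp [ha.extend_apply]

/-- Solutions over `Ω` of linear systems over `F`: `A` of rank `q` has `|I| - q` free rows and
`|J| - q` free columns. -/
theorem exists_free_rows_columns [DecidableEq I] [DecidableEq J] (A : Matrix I J F) :
    ∃ (S : Finset I) (B : Finset J) (q : ℕ), S.card + q = Fintype.card I ∧
      B.card + q = Fintype.card J ∧
      (∀ τ : I → Ω, ∃ w : I → Ω, (∀ s ∈ S, w s = τ s) ∧
        ∀ b, ∑ i, w i * algebraMap F Ω (A i b) = 0) ∧
      ∀ G : J → Ω, (∀ i, ∑ b, G b * algebraMap F Ω (A i b) = 0) →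
        ∀ b, ∃ E : J → F, G b = ∑ b' ∈ B, algebraMap F Ω (E b') * G b' := by
  obtain ⟨S, hS, -, hSD⟩ := exists_maximal_independent (F := F) A.row
  obtain ⟨B, hB, hBli, hBD⟩ := exists_maximal_independent (F := F) A.col
  rw [← Matrix.rank_eq_finrank_span_row] at hS
  rw [← Matrix.rank_eq_finrank_span_cols] at hB
  choose D hD using hSD
  choose E hE using hBD
  refine ⟨Sᶜ, Bᶜ, A.rank, ?_, ?_, fun τ => ?_, fun G hG b => ?_⟩
  · rw [← hS, Finset.card_compl_add_card]
  · rw [← hB, Finset.card_compl_add_card]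
  -- Here `S` indexes a basis of the row space. The other rows are combinations of these, so
  -- arbitrary values off `S` extend to a solution.
  · refine ⟨fun i => if i ∈ S then -∑ s ∈ Sᶜ, τ s * algebraMap F Ω (D s i) else τ i,
      fun s hs => if_neg (Finset.mem_compl.1 hs), fun b => ?_⟩
    rw [← Finset.sum_add_sum_compl S]
    have h1 : ∑ i ∈ Sᶜ, (if i ∈ S then -∑ s ∈ Sᶜ, τ s * algebraMap F Ω (D s i) else τ i) *
        algebraMap F Ω (A i b) =
        ∑ i ∈ Sᶜ, ∑ s ∈ S, τ i * algebraMap F Ω (D i s) * algebraMap F Ω (A s b) := by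
      refine Finset.sum_congr rfl fun i hi => ?_
      rw [if_neg (Finset.mem_compl.1 hi)]
      have := congrFun (hD i) b
      simp only [Matrix.row, Finset.sum_apply, Pi.smul_apply, smul_eq_mul] at this
      rw [this, map_sum, Finset.mul_sum]
      simp only [map_mul, mul_assoc]
    rw [h1, Finset.sum_comm, ← Finset.sum_add_distrib]
    refine Finset.sum_eq_zero fun i hi => ?_
    dsimp only
    rw [if_pos hi, neg_mul, Finset.sum_mul, neg_add_cancel]
  · by_cases hb : b ∈ B
    swap
    · refine ⟨Pi.single b 1, ?_⟩
      rw [Finset.sum_eq_single b]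
      · simp
      · intro b' _ h; simp [Pi.single_eq_of_ne h]
      · intro h; exact absurd (Finset.mem_compl.2 hb) h
    -- The relation `∑ G b' • col b' = 0` is hit with the functional dual to column `b` in the
    -- column basis `B`, which solves for `G b`.
    obtain ⟨φ, hφ⟩ : ∃ φ : (I → F) →ₗ[F] F, ∀ b' ∈ B, φ (A.col b') = if b' = b then 1 else 0 := by
      obtain ⟨g, hg⟩ := (Fintype.linearCombination F (fun i : B => A.col i)).exists_leftInverse_of_injective
        (LinearMap.ker_eq_bot.2 hBli.fintypeLinearCombination_injective)
      refine ⟨LinearMap.proj ⟨b, hb⟩ ∘ₗ g, fun b' hb' => ?_⟩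
      have h := congrFun (LinearMap.congr_fun hg (Pi.single ⟨b', hb'⟩ 1)) ⟨b, hb⟩
      rw [LinearMap.comp_apply, Fintype.linearCombination_apply_single, one_smul] at h
      rw [LinearMap.comp_apply, LinearMap.proj_apply, h, LinearMap.id_apply, Pi.single_apply]
      simp [eq_comm]
    refine ⟨fun b' => -φ (A.col b'), ?_⟩
    have hφsum : ∀ b', algebraMap F Ω (φ (A.col b')) =
        ∑ i, algebraMap F Ω (A i b') * algebraMap F Ω (φ (Pi.single i 1)) := by
      intro b'
      rw [LinearMap.pi_apply_eq_sum_univ φ (A.col b'), map_sum]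
      refine Finset.sum_congr rfl fun i _ => ?_
      rw [smul_eq_mul, map_mul]
      congr 3
      ext i'
      simp [Pi.single_apply, eq_comm]
    have h0 : ∑ b', G b' * algebraMap F Ω (φ (A.col b')) = 0 := by
      simp only [hφsum, Finset.mul_sum]
      rw [Finset.sum_comm]
      refine Finset.sum_eq_zero fun i _ => ?_
      rw [← zero_mul (algebraMap F Ω (φ (Pi.single i 1))), ← hG i, Finset.sum_mul]
      exact Finset.sum_congr rfl fun b' _ => (mul_assoc _ _ _).symm
    rw [← Finset.sum_add_sum_compl B, Finset.sum_eq_single b] at h0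
    · rw [hφ b hb, if_pos rfl, map_one, mul_one] at h0
      rw [eq_neg_of_add_eq_zero_left h0, ← Finset.sum_neg_distrib]
      refine Finset.sum_congr rfl fun b' _ => ?_
      rw [map_neg]; ring
    · intro b' hb' hne
      rw [hφ b' hb', if_neg hne, map_zero, mul_zero]
    · intro h; exact absurd hb h

end LinearSystem

/-! ### Degenerate points of generic linear combinations -/

section Generic

variable {k Ω : Type*} [Field k] [Field Ω] [Algebra k Ω] {N m t r : ℕ}

/-- Consider `r` generic linear combinations, with coefficients `x (inl (a, b))`, of the bilinear
maps `c · · b`. If they are dependent at a point `u`, then `u` occurs in a rank one element `w ⊗ u`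
annihilated by all the `c · · b`, whose coordinates have transcendence degree more than `N - r`. -/
theorem exists_rank_one_of_dependent (c : Fin N → Fin m → Fin t → k)
    {x : (Fin r × Fin t) ⊕ Fin N → Ω} (hx : AlgebraicIndependent k x) (hm : m + r ≤ N + 1)
    {u : Fin m → Ω} (hu : u ≠ 0) {s : Fin r → Ω} (hs : s ≠ 0)
    (h : ∀ i, ∑ a, s a * ∑ l, (∑ b, x (.inl (a, b)) * algebraMap k Ω (c i l b)) * u l = 0) :
    ∃ (w : Fin N → Ω) (u : Fin m → Ω),
      (∀ b, ∑ i, ∑ l, w i * u l * algebraMap k Ω (c i l b) = 0) ∧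
      ∀ (d : ℕ) (y : Fin d → Ω), (∀ i l, w i * u l ∈ relClosure k (Set.range y)) → N + 1 ≤ d + r := by
  obtain ⟨l₀, hl₀⟩ := Function.ne_iff.1 hu
  obtain ⟨a₀, ha₀⟩ := Function.ne_iff.1 hs
  wlog hu1 : u l₀ = 1 generalizing u
  · refine this (u := (u l₀)⁻¹ • u) (smul_ne_zero (inv_ne_zero hl₀) hu) (fun i => ?_) ?_ ?_
    · rw [← mul_zero (u l₀)⁻¹, ← h i]
      simp only [Finset.mul_sum, Pi.smul_apply, smul_eq_mul]
      refine Finset.sum_congr rfl fun a _ => Finset.sum_congr rfl fun l _ => ?_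
      ring
    · simp [inv_mul_cancel₀ hl₀]
    · simp [inv_mul_cancel₀ hl₀]
  wlog hs1 : s a₀ = 1 generalizing s
  · refine this (s := (s a₀)⁻¹ • s) (smul_ne_zero (inv_ne_zero ha₀) hs) ?_ (fun i => ?_) ?_
    · simp [inv_mul_cancel₀ ha₀]
    · rw [← mul_zero (s a₀)⁻¹, ← h i]
      simp only [Finset.mul_sum, Pi.smul_apply, smul_eq_mul, mul_assoc]
    · simp [inv_mul_cancel₀ ha₀]
  -- Over `k(u)`, the dependence says that `G = ∑ s_a x_a` is in the kernel of `A`, while `w` has to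
  -- be in its left kernel. If `A` has rank `q`, then `t - q` entries determine `G`, and `N - q`
  -- entries of `w` are free; these receive fresh indeterminates.
  let κ := IntermediateField.adjoin k (Set.range u)
  have huκ : ∀ l, u l ∈ κ := fun l => IntermediateField.subset_adjoin _ _ ⟨l, rfl⟩
  let A : Matrix (Fin N) (Fin t) κ := fun i b => ∑ l, algebraMap k κ (c i l b) * ⟨u l, huκ l⟩
  have hA : ∀ i b, algebraMap κ Ω (A i b) = ∑ l, algebraMap k Ω (c i l b) * u l := fun i b => by
    simp only [A, map_sum, map_mul]
    rfl
  obtain ⟨S, B, q, hS, hB, hw, hG⟩ := exists_free_rows_columns (Ω := Ω) A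
  obtain ⟨w, hwS, hwA⟩ := hw fun i => x (.inr i)
  let G : Fin t → Ω := fun b => ∑ a, s a * x (.inl (a, b))
  have hGA : ∀ i, ∑ b, G b * algebraMap κ Ω (A i b) = 0 := fun i => by
    rw [← h i]
    have (a : Fin r) : ∑ l, (∑ b, x (.inl (a, b)) * algebraMap k Ω (c i l b)) * u l =
        ∑ b, x (.inl (a, b)) * algebraMap κ Ω (A i b) := by
      simp only [hA, Finset.mul_sum, Finset.sum_mul, mul_assoc]
      exact Finset.sum_comm
    simp only [this]
    simp only [G, Finset.mul_sum, Finset.sum_mul, mul_assoc]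
    exact Finset.sum_comm
  -- the transcendence degree count
  have count : ∀ {τ : Type} [Fintype τ] (y : τ → Ω), (∀ l, u l ∈ relClosure k (Set.range y)) →
      (∀ i ∈ S, x (.inr i) ∈ relClosure k (Set.range y)) → N + 1 ≤ Fintype.card τ + r := by
    intro τ _ y hyu hyS
    -- As `s_{a₀} = 1`, row `x_{a₀}` is recovered from `G` and the other rows. The list has `|τ| +
    -- (t - q) + (r - 1) + (r - 1) t + q` entries, and all `r t + N` indeterminates are algebraic
    -- over it.
    let T : τ ⊕ (B ⊕ {a // a ≠ a₀} ⊕ ({a // a ≠ a₀} × Fin t) ⊕ (Sᶜ : Finset (Fin N))) → Ω :=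
      Sum.elim y (Sum.elim (fun b => G b) (Sum.elim (fun a => s a)
        (Sum.elim (fun p => x (.inl (p.1, p.2))) (fun i => x (.inr i)))))
    set K := relClosure k (Set.range T) with hK
    have hT : ∀ i, T i ∈ K := fun i => subset_relClosure _ ⟨i, rfl⟩
    have hyK : relClosure k (Set.range y) ≤ K := relClosure_le (by
      rintro _ ⟨i, rfl⟩; exact hT (.inl i))
    have hκK : κ ≤ K := IntermediateField.adjoin_le_iff.2 (by
      rintro _ ⟨l, rfl⟩; exact hyK (hyu l))
    have hGK : ∀ b, G b ∈ K := fun b => by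
      obtain ⟨E, hE⟩ := hG G hGA b
      rw [hE]
      exact sum_mem fun b' hb' => mul_mem (hκK (E b').2) (hT (.inr (.inl ⟨b', hb'⟩)))
    have hsK : ∀ a, s a ∈ K := fun a => by
      by_cases ha : a = a₀
      · rw [ha, hs1]; exact one_mem _
      · exact hT (.inr (.inr (.inl ⟨a, ha⟩)))
    have hxK : ∀ a ≠ a₀, ∀ b, x (.inl (a, b)) ∈ K := fun a ha b =>
      hT (.inr (.inr (.inr (.inl (⟨a, ha⟩, b)))))
    have hall : ∀ i, x i ∈ K := by
      rintro (⟨a, b⟩ | i)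
      · by_cases ha : a = a₀
        · have : x (.inl (a, b)) = G b - ∑ a ∈ Finset.univ.erase a₀, s a * x (.inl (a, b)) := by
            have := Finset.add_sum_erase Finset.univ (fun a => s a * x (.inl (a, b))) (Finset.mem_univ a₀)
            rw [hs1, one_mul] at this
            rw [ha, eq_sub_iff_add_eq]
            exact this
          rw [this]
          exact sub_mem (hGK b) (sum_mem fun a' ha' =>
            mul_mem (hsK a') (hxK a' (Finset.ne_of_mem_erase ha') b))
        · exact hxK a ha b
      · by_cases hi : i ∈ S
        · exact hyK (hyS i hi)
        · exact hT (.inr (.inr (.inr (.inr ⟨i, Finset.mem_compl.2 hi⟩))))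
    have hcard := card_le_of_mem_relClosure hx T hall
    have hr : Fintype.card {a // a ≠ a₀} + 1 = r := by
      have := a₀.pos
      simp; omega
    have hSc : (Sᶜ).card + S.card = N := by
      rw [Finset.card_compl_add_card, Fintype.card_fin]
    simp only [Fintype.card_sum, Fintype.card_prod, Fintype.card_fin, Fintype.card_coe] at hcard hS hB
    generalize Fintype.card {a // a ≠ a₀} = r' at hcard hr
    subst hr
    have : (r' + 1) * t = r' * t + t := by ring
    omega
  have hl₀m : Fintype.card {l // l ≠ l₀} + 1 = m := by
    have := l₀.pos
    simp; omega
  -- some row is free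
  obtain ⟨i₀, hi₀⟩ : S.Nonempty := by
    by_contra hS0
    rw [Finset.not_nonempty_iff_eq_empty] at hS0
    -- If no row were free, the `m - 1` coordinates of `u` other than `u l₀ = 1` would suffice,
    -- against `hm`.
    have := count (fun l : {l // l ≠ l₀} => u l) (fun l => ?_) (by simp [hS0])
    · omega
    · by_cases hl : l = l₀
      · rw [hl, hu1]; exact one_mem _
      · exact subset_relClosure _ ⟨⟨l, hl⟩, rfl⟩
  refine ⟨w, u, fun b => ?_, fun d y hy => ?_⟩
  · rw [← hwA b]
    refine Finset.sum_congr rfl fun i _ => ?_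
    rw [hA, Finset.mul_sum]
    exact Finset.sum_congr rfl fun l _ => by ring
  · have hwy : ∀ i, w i ∈ relClosure k (Set.range y) := fun i => by
      have := hy i l₀
      rwa [hu1, mul_one] at this
    have hwi₀ : w i₀ ≠ 0 := by
      rw [hwS i₀ hi₀]; exact hx.ne_zero _
    have := count y (fun l => ?_) (fun i hi => by rw [← hwS i hi]; exact hwy i)
    · simpa using this
    · have h1 := div_mem (hy i₀ l) (hwy i₀)
      rwa [mul_div_cancel_left₀ _ hwi₀] at h1

end Generic

/-! ### Structure constants and the variety of rank one syzygies -/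

section StructureConstants

/-- Coordinates on the span of the `v i` extend to functionals on `M`. Having coefficients of the
form `f b (v i)` makes the relations of `exists_coordinates` applicable to them. -/
theorem exists_structure_constants {k M I : Type*} [Field k] [AddCommGroup M] [Module k M] [Finite I]
    (v : I → M) : ∃ (t : ℕ) (g : Fin t → M) (f : Fin t → Module.Dual k M),
      ∀ i, v i = ∑ b, f b (v i) • g b := by
  have : FiniteDimensional k (Submodule.span k (Set.range v)) :=
    FiniteDimensional.span_of_finite k (Set.finite_range v)
  let B := Module.finBasis k (Submodule.span k (Set.range v))
  choose f hf using fun b => (B.coord b).exists_extend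
  refine ⟨_, fun b => B b, f, fun i => ?_⟩
  have h := congrArg Subtype.val (B.sum_repr ⟨v i, Submodule.subset_span ⟨i, rfl⟩⟩)
  rw [AddSubmonoidClass.coe_finsetSum] at h
  refine h.symm.trans (Finset.sum_congr rfl fun b _ => ?_)
  rw [Submodule.coe_smul]
  congr 1
  exact (LinearMap.congr_fun (hf b) ⟨v i, Submodule.subset_span ⟨i, rfl⟩⟩).symm

end StructureConstants

section RankOneLocus

variable {k : Type*} [Field k] {A : Type*} {n : ℕ}
variable {M : Type*} [AddCommGroup M] [Module k M] [Module (MvPolynomial (Fin (n + 1)) k) M]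
variable {ℳ : A → Submodule k M} {a : A}

/-- A matrix over a field with vanishing `2 × 2` minors has rank at most one, and the linear
equations express `w m = 0`. Only this inclusion into `R_a(M)` is needed. -/
theorem mem_rankOneSyzygies [Fintype (BasisIndex ℳ a)] {t : ℕ} {g : Fin t → M}
    {c : Fin (n + 1) → BasisIndex ℳ a → Fin t → k}
    (hc : ∀ i l, (MvPolynomial.X i : MvPolynomial (Fin (n + 1)) k) •
      (Module.Basis.ofVectorSpace k (ℳ a) l : M) = ∑ b, c i l b • g b)
    (p : PrimeSpectrum (CoordRing n ℳ a))
    (hminor : ∀ i i' l l', (MvPolynomial.X (i, l) * MvPolynomial.X (i', l') -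
      MvPolynomial.X (i, l') * MvPolynomial.X (i', l) : CoordRing n ℳ a) ∈ p.asIdeal)
    (hlin : ∀ b, (∑ i, ∑ l, c i l b • MvPolynomial.X (i, l) : CoordRing n ℳ a) ∈ p.asIdeal) :
    p ∈ rankOneSyzygies n ℳ a := by
  let ξ : Fin (n + 1) → BasisIndex ℳ a → p.asIdeal.ResidueField := fun i l =>
    algebraMap (CoordRing n ℳ a) _ (MvPolynomial.X (i, l))
  have hξ : ∀ i i' l l', ξ i l * ξ i' l' = ξ i l' * ξ i' l := fun i i' l l' => by
    have := Ideal.algebraMap_residueField_eq_zero.2 (hminor i i' l l')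
    rwa [map_sub, map_mul, map_mul, sub_eq_zero] at this
  have hξlin : ∀ b, ∑ i, ∑ l, c i l b • ξ i l = 0 := fun b => by
    have := Ideal.algebraMap_residueField_eq_zero.2 (hlin b)
    change IsScalarTower.toAlgHom k (CoordRing n ℳ a) p.asIdeal.ResidueField _ = 0 at this
    simp only [map_sum, map_smul] at this
    exact this
  obtain ⟨u, v, huv⟩ : ∃ (u : Fin (n + 1) → p.asIdeal.ResidueField)
      (v : BasisIndex ℳ a → p.asIdeal.ResidueField), ∀ i l, ξ i l = u i * v l := by
    by_cases h0 : ∀ i l, ξ i l = 0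
    · exact ⟨0, 0, fun i l => by simp [h0]⟩
    · push Not at h0
      obtain ⟨i₀, l₀, h0⟩ := h0
      refine ⟨fun i => ξ i l₀, fun l => ξ i₀ l / ξ i₀ l₀, fun i l => ?_⟩
      rw [mul_div_assoc', eq_div_iff h0, hξ]
  refine ⟨u, Finsupp.equivFunOnFinite.symm v, fun i l => huv i l, ?_⟩
  have h1 : ∀ i, (Finsupp.equivFunOnFinite.symm v).sum (fun l c => (u i * c) ⊗ₜ[k]
      ((MvPolynomial.X i : MvPolynomial (Fin (n + 1)) k) •
      (Module.Basis.ofVectorSpace k (ℳ a) l : M))) =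
      ∑ b, (∑ l, c i l b • ξ i l) ⊗ₜ[k] g b := by
    intro i
    rw [Finsupp.sum_fintype _ _ (by simp)]
    simp only [Finsupp.equivFunOnFinite_symm_apply_apply, ← huv, hc, TensorProduct.tmul_sum,
      TensorProduct.sum_tmul, TensorProduct.tmul_smul, TensorProduct.smul_tmul']
    exact Finset.sum_comm
  simp only [h1]
  rw [Finset.sum_comm]
  simp only [← TensorProduct.sum_tmul, hξlin, TensorProduct.zero_tmul, Finset.sum_const_zero]

theorem ringKrullDim_quotient_le_topologicalKrullDim {R : Type*} [CommRing R] (I : Ideal R)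
    (Z : Set (PrimeSpectrum R)) (hZ : ∀ p : PrimeSpectrum R, I ≤ p.asIdeal → p ∈ Z) :
    ringKrullDim (R ⧸ I) ≤ topologicalKrullDim Z := by
  rw [← PrimeSpectrum.topologicalKrullDim_eq_ringKrullDim]
  have hind : Topology.IsInducing (PrimeSpectrum.comap (Ideal.Quotient.mk I)) :=
    (PrimeSpectrum.isClosedEmbedding_comap_of_surjective _ _
      Ideal.Quotient.mk_surjective).isInducing
  have hmem : ∀ q, PrimeSpectrum.comap (Ideal.Quotient.mk I) q ∈ Z := fun q => hZ _ fun x hx => by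
    rw [PrimeSpectrum.comap_asIdeal, Ideal.mem_comap, Ideal.Quotient.eq_zero_iff_mem.2 hx]
    exact zero_mem _
  exact (hind.codRestrict hmem).topologicalKrullDim_le

/-- The minors and the linear equations vanish at the `Ω`-point `(w_i u_l)`, so its closure lies in
`R_a(M)`. -/
theorem exists_le_topologicalKrullDim_rankOneSyzygies [Fintype (BasisIndex ℳ a)] {t : ℕ}
    {g : Fin t → M} {c : Fin (n + 1) → BasisIndex ℳ a → Fin t → k}
    (hc : ∀ i l, (MvPolynomial.X i : MvPolynomial (Fin (n + 1)) k) •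
      (Module.Basis.ofVectorSpace k (ℳ a) l : M) = ∑ b, c i l b • g b)
    {Ω : Type*} [Field Ω] [Algebra k Ω] (w : Fin (n + 1) → Ω) (u : BasisIndex ℳ a → Ω)
    (hwu : ∀ b, ∑ i, ∑ l, w i * u l * algebraMap k Ω (c i l b) = 0) :
    ∃ (d : ℕ) (y : Fin d → Ω), (∀ i l, w i * u l ∈ relClosure k (Set.range y)) ∧
      (d : WithBot ℕ∞) ≤ topologicalKrullDim (rankOneSyzygies n ℳ a) := by
  obtain ⟨d, y, hy, hd⟩ := exists_algebraic_le_ringKrullDim (k := k)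
    (fun p : Fin (n + 1) × BasisIndex ℳ a => w p.1 * u p.2)
  refine ⟨d, y, fun i l => hy (i, l), hd.trans
    (ringKrullDim_quotient_le_topologicalKrullDim _ _ fun p hp =>
      mem_rankOneSyzygies hc p (fun i i' l l' => hp ?_) fun b => hp ?_)⟩
  · rw [RingHom.mem_ker]
    simp
    ring
  · rw [RingHom.mem_ker, ← hwu b]
    simp only [map_sum, map_smul, MvPolynomial.aeval_X]
    refine Finset.sum_congr rfl fun i _ => Finset.sum_congr rfl fun l _ => ?_
    rw [Algebra.smul_def, mul_comm]

end RankOneLocus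

theorem sum_mul_sum_comm {R I J T : Type*} [CommSemiring R] [Fintype I] [Fintype J] [Fintype T]
    (x : T → R) (c : I → J → T → R) (f : I → J → R) :
    ∑ i, ∑ l, (∑ b, x b * c i l b) * f i l = ∑ b, x b * ∑ i, ∑ l, c i l b * f i l := by
  simp only [Finset.mul_sum, Finset.sum_mul, mul_assoc]
  rw [Finset.sum_congr rfl fun i _ => Finset.sum_comm, Finset.sum_comm]

/-! ### Coordinates of `K_a(M)` -/

section Coordinates

variable {k : Type*} [Field k] {A : Type*} [AddCommGroup A] {n : ℕ} {w : Fin (n + 1) → A}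
variable {M : Type*} [AddCommGroup M] [Module k M] [Module (MvPolynomial (Fin (n + 1)) k) M]
  [IsScalarTower k (MvPolynomial (Fin (n + 1)) k) M]
variable {ℳ : A → Submodule k M} {a : A}

theorem mem_span_prod_e (y : ExtAlg k n) :
    y ∈ Submodule.span k (Set.range fun s : List (Fin (n + 1)) => (s.map (e k)).prod) := by
  induction y using ExteriorAlgebra.induction with
  | algebraMap r =>
    rw [Algebra.algebraMap_eq_smul_one]
    exact Submodule.smul_mem _ _ (Submodule.subset_span ⟨[], rfl⟩)
  | ι v =>
    rw [LinearMap.pi_apply_eq_sum_univ (ExteriorAlgebra.ι k) v]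
    refine sum_mem fun i _ => Submodule.smul_mem _ _ (Submodule.subset_span ⟨[i], ?_⟩)
    simp only [List.map_cons, List.map_nil, List.prod_cons, List.prod_nil, mul_one, e]
    congr 1
    ext j
    simp [Pi.single_apply, eq_comm]
  | mul y z hy hz =>
    have h := Submodule.mul_mem_mul hy hz
    rw [Submodule.span_mul_span] at h
    refine Submodule.span_mono ?_ h
    rintro _ ⟨_, ⟨s, rfl⟩, _, ⟨s', rfl⟩, rfl⟩
    exact ⟨s ++ s', by simp⟩
  | add y z hy hz => exact add_mem hy hz

/-- An element of `ω_E ⊗ M_a` of degree `(c; j)` in coordinates. -/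
theorem exists_coordinates {ι : Type*} [Fintype ι] (B : Module.Basis ι k (ℳ a)) {c : A} {j : ℤ}
    {y : OmegaE k n ⊗[k] ℳ a} (hy : y ∈ Kcomp w ℳ a c j) :
    ∃ f : ι → OmegaE k n, y = ∑ l, f l ⊗ₜ B l ∧ (∀ l, f l ∈ omegaComp k w (c - a) j) ∧
      ∀ (φ : Module.Dual k M) (x : ExtAlg k n),
        ∑ i, ∑ l, φ ((MvPolynomial.X i : MvPolynomial (Fin (n + 1)) k) • (B l : M)) *
          (f l).toDual (x * e k i) = 0 := by
  have hz : ∀ z : omegaComp k w (c - a) j ⊗[k] ℳ a,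
      ∃ f : ι → omegaComp k w (c - a) j, z = ∑ l, f l ⊗ₜ B l := by
    intro z
    induction z using TensorProduct.induction_on with
    | zero => exact ⟨0, by simp⟩
    | add z z' hz hz' =>
      obtain ⟨f, rfl⟩ := hz
      obtain ⟨f', rfl⟩ := hz'
      exact ⟨f + f', by simp [TensorProduct.add_tmul, Finset.sum_add_distrib]⟩
    | tmul f m =>
      refine ⟨fun l => B.repr m l • f, ?_⟩
      conv_lhs => rw [← B.sum_repr m, TensorProduct.tmul_sum]
      exact Finset.sum_congr rfl fun l _ => (TensorProduct.smul_tmul _ _ _).symm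
  obtain ⟨hK, z, rfl⟩ := hy
  obtain ⟨f, rfl⟩ := hz z
  have hy : LinearMap.rTensor (ℳ a) (omegaComp k w (c - a) j).subtype (∑ l, f l ⊗ₜ B l) =
      ∑ l, (f l : OmegaE k n) ⊗ₜ B l := by simp
  refine ⟨fun l => f l, hy, fun l => (f l).2, fun φ x => ?_⟩
  rw [hy] at hK
  have hK : dR ℳ a (∑ l, (f l : OmegaE k n) ⊗ₜ B l) = 0 := hK
  let ev : OmegaE k n →ₗ[k] k :=
    { toFun := fun f => f.toDual x, map_add' := fun _ _ => rfl, map_smul' := fun _ _ => rfl }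
  have h := congrArg (TensorProduct.lift ((LinearMap.mul k k).compl₁₂ ev φ)) hK
  simp only [map_sum, dR, LinearMap.sum_apply, TensorProduct.map_tmul, map_zero,
    TensorProduct.lift.tmul, LinearMap.compl₁₂_apply] at h
  -- The sign comes from the involution: `e_i f` takes the value `-f(x e_i)` at `x`.
  rw [Finset.sum_comm, ← neg_eq_zero, ← Finset.sum_neg_distrib, ← h]
  refine Finset.sum_congr rfl fun l _ => ?_
  rw [← Finset.sum_neg_distrib]
  refine Finset.sum_congr rfl fun i _ => ?_
  change _ = OmegaE.toDual (e k i • (f l : OmegaE k n)) x * _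
  rw [OmegaE.smul_apply, involute_e, mul_neg, map_neg, neg_mul, mul_comm]
  rfl

/-- A nonzero element of `K_a(M)` of degree `j ≥ dim M_a` forces `dim R_a(M) ≥ j`. -/
theorem natCast_le_topologicalKrullDim_rankOneSyzygies [Fintype (BasisIndex ℳ a)] {c : A} {j : ℕ}
    (hj : Fintype.card (BasisIndex ℳ a) ≤ j) (hK : Kcomp w ℳ a c j ≠ ⊥) :
    (j : WithBot ℕ∞) ≤ topologicalKrullDim (rankOneSyzygies n ℳ a) := by
  obtain ⟨y, hy, hy0⟩ := (Submodule.ne_bot_iff _).1 hK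
  set m := Fintype.card (BasisIndex ℳ a) with hm
  let B := Module.Basis.ofVectorSpace k (ℳ a)
  let ε : BasisIndex ℳ a ≃ Fin m := Fintype.equivFin _
  obtain ⟨f, rfl, hfdeg, hf⟩ := exists_coordinates B hy
  obtain ⟨t, g, φ, hφ⟩ := exists_structure_constants (k := k)
    (fun p : Fin (n + 1) × BasisIndex ℳ a =>
      (MvPolynomial.X p.1 : MvPolynomial (Fin (n + 1)) k) • (B p.2 : M))
  let c' : Fin (n + 1) → Fin m → Fin t → k := fun i l b =>
    φ b ((MvPolynomial.X i : MvPolynomial (Fin (n + 1)) k) • (B (ε.symm l) : M))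
  -- This is the least `r` with `r + j > n + 1`. If the subtraction truncates, `r = 0` and there is
  -- no degenerate point; otherwise the count `n + 2 ≤ d' + r` reads `j ≤ d'`.
  let r := n + 2 - j
  let Ω := AlgebraicClosure (FractionRing (MvPolynomial ((Fin r × Fin t) ⊕ Fin (n + 1)) k))
  -- The `inl` indeterminates are coefficients of the generic combinations; the `inr` ones fill the
  -- free entries of `w`.
  let x : (Fin r × Fin t) ⊕ Fin (n + 1) → Ω := fun i =>
    algebraMap (MvPolynomial ((Fin r × Fin t) ⊕ Fin (n + 1)) k) Ω (MvPolynomial.X i)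
  have hx : AlgebraicIndependent k x :=
    (MvPolynomial.algebraicIndependent_X _ k).map'
      (f := IsScalarTower.toAlgHom k (MvPolynomial ((Fin r × Fin t) ⊕ Fin (n + 1)) k) Ω)
      (by
        change Function.Injective (algebraMap _ Ω)
        rw [IsScalarTower.algebraMap_eq _ (FractionRing (MvPolynomial ((Fin r × Fin t) ⊕ Fin (n + 1)) k)) Ω]
        exact (FaithfulSMul.algebraMap_injective
          (FractionRing (MvPolynomial ((Fin r × Fin t) ⊕ Fin (n + 1)) k)) Ω).comp (IsFractionRing.injective _ _))
  let d : Fin r → Fin (n + 1) → Fin m → Ω := fun a i l =>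
    ∑ b, x (.inl (a, b)) * algebraMap k Ω (c' i l b)
  by_cases hd : ∀ u : Fin m → Ω, u ≠ 0 → ∀ s : Fin r → Ω,
      (∀ i, ∑ a, s a * ∑ l, d a i l * u l = 0) → s = 0
  · refine absurd (Finset.sum_eq_zero fun l _ => ?_) hy0
    suffices h : (f l).toDual = 0 by
      have : f l = 0 := h
      rw [this, TensorProduct.zero_tmul]
    have hprod : ∀ s : List (Fin (n + 1)), (f l).toDual (s.map (e k)).prod = 0 := by
      intro s
      by_cases hs : s.length = j
      · have := functional_eq_zero d hd (fun l => (f (ε.symm l)).toDual) (fun a y => ?_) s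
          (by omega) (ε l)
        · simpa using this
        · have h0 : ∀ b, ∑ i, ∑ l, c' i l b * (f (ε.symm l)).toDual (y * e k i) = 0 := fun b => by
            rw [← hf (φ b) y]
            refine Finset.sum_congr rfl fun i _ => ?_
            exact ε.symm.sum_comp fun l => φ b ((MvPolynomial.X i : MvPolynomial (Fin (n + 1)) k) •
              (B l : M)) * (f l).toDual (y * e k i)
          calc _ = ∑ b, x (.inl (a, b)) * algebraMap k Ω
                (∑ i, ∑ l, c' i l b * (f (ε.symm l)).toDual (y * e k i)) := by
                simp only [map_sum, map_mul]
                exact sum_mul_sum_comm _ _ _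
            _ = 0 := by simp only [h0, map_zero, mul_zero, Finset.sum_const_zero]
      · refine hfdeg l (-(s.map w).sum) (-(s.length : ℤ)) (fun h => hs ?_) _
          (Submodule.subset_span ⟨s, rfl, rfl, rfl⟩)
        have := congrArg Prod.snd h
        dsimp only at this
        omega
    exact LinearMap.ext fun Y =>
      Submodule.span_le (p := LinearMap.ker (f l).toDual).2 (by rintro _ ⟨s, rfl⟩; exact hprod s)
        (mem_span_prod_e Y)
  · push Not at hd
    obtain ⟨u, hu, s, hs, hs0⟩ := hd
    obtain ⟨a₀, -⟩ := Function.ne_iff.1 hs0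
    have hr := a₀.pos
    -- The hypothesis `m ≤ j` enters here, as `m + r ≤ n + 2`.
    obtain ⟨w', u', hwu, hcount⟩ := exists_rank_one_of_dependent c' hx (by omega) hu hs0 hs
    obtain ⟨d', y, hy, hd'⟩ := exists_le_topologicalKrullDim_rankOneSyzygies (n := n) (ℳ := ℳ)
      (a := a) (g := g) (c := fun i l b => c' i (ε l) b)
      (fun i l => by simpa only [c', ε.symm_apply_apply] using hφ (i, l)) w' (fun l => u' (ε l))
      (fun b => by
        rw [← hwu b]
        refine Finset.sum_congr rfl fun i _ => ?_
        exact ε.sum_comp fun l => w' i * u' l * algebraMap k Ω (c' i l b))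
    refine le_trans ?_ hd'
    have := hcount d' y fun i l => by simpa using hy i (ε.symm l)
    exact_mod_cast (by omega : j ≤ d')

end Coordinates

end MultigradedLST

end

/-! ### The bound on the length of the strand -/

open MultigradedLST in
theorem mainTheorem3 {k : Type*} [Field k] {A : Type*} [AddCommGroup A] [DecidableEq A]
    {n : ℕ} (w : Fin (n + 1) → A)
    {M : Type*} [AddCommGroup M] [Module k M] [Module (MvPolynomial (Fin (n + 1)) k) M]
    [IsScalarTower k (MvPolynomial (Fin (n + 1)) k) M]
    (ℳ : A → Submodule k M) [DirectSum.Decomposition ℳ]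
    [SetLike.GradedSMul (MvPolynomial.weightedHomogeneousSubmodule k w) ℳ]
    (hM : BoundedBelow w ℳ) (a : A) (ha : IsMinimalEff w ℳ a) :
    ((complexLength (stronglyLinearStrand w ℳ a) : ℕ∞) : WithBot ℕ∞) ≤
      max ((Cardinal.toENat (Module.rank k (ℳ a)) - 1 : ℕ∞) : WithBot ℕ∞)
        (topologicalKrullDim (rankOneSyzygies n ℳ a)) := by
  by_cases hfin : FiniteDimensional k (ℳ a)
  swap
  · have htop : Cardinal.toENat (Module.rank k (ℳ a)) = ⊤ := by
      rw [Cardinal.toENat_eq_top, ← not_lt]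
      exact fun h => hfin (Module.rank_lt_aleph0_iff.1 h)
    rw [htop]
    exact le_max_of_le_left (WithBot.coe_le_coe.2 le_top)
  have : Fintype (BasisIndex ℳ a) :=
    FiniteDimensional.fintypeBasisIndex (Module.Basis.ofVectorSpace k (ℳ a))
  have hrank : Module.rank k (ℳ a) = Fintype.card (BasisIndex ℳ a) :=
    rank_eq_card_basis (Module.Basis.ofVectorSpace k (ℳ a))
  have hpos : 0 < Fintype.card (BasisIndex ℳ a) := by
    have : Nontrivial (ℳ a) := Submodule.nontrivial_iff_ne_bot.2 ha.1
    have := (rank_pos_iff_nontrivial (R := k) (M := ℳ a)).2 inferInstance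
    rw [hrank] at this
    exact_mod_cast this
  have key : ∀ j : ℕ, Nontrivial ((stronglyLinearStrand w ℳ a).X (j : ℤ)) →
      ((j : ℕ∞) : WithBot ℕ∞) ≤ max ((Cardinal.toENat (Module.rank k (ℳ a)) - 1 : ℕ∞) : WithBot ℕ∞)
        (topologicalKrullDim (rankOneSyzygies n ℳ a)) := by
    intro j hj
    rcases lt_or_ge j (Fintype.card (BasisIndex ℳ a)) with hlt | hge
    · refine le_max_of_le_left (WithBot.coe_le_coe.2 ?_)
      rw [hrank, map_natCast]
      exact_mod_cast (by omega : j ≤ Fintype.card (BasisIndex ℳ a) - 1)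
    · refine le_max_of_le_right ?_
      obtain ⟨c, hc⟩ : ∃ c, Kcomp w ℳ a c (j : ℤ) ≠ ⊥ := by
        by_contra! h
        have hj' : Nontrivial (LTerm n (Kcomp w ℳ a) (j : ℤ)) := hj
        refine not_subsingleton (LTerm n (Kcomp w ℳ a) (j : ℤ)) ⟨fun x y => ?_⟩
        ext c : 1
        have : Subsingleton (Kcomp w ℳ a c (j : ℤ)) := by
          rw [h c]; infer_instance
        exact Subsingleton.elim _ _
      exact natCast_le_topologicalKrullDim_rankOneSyzygies hge hc
  -- The maximum is not `⊥`, since its first term is not, so the supremum can be bounded inside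
  -- `ℕ∞`.
  obtain ⟨b, hb⟩ := WithBot.ne_bot_iff_exists.1 (ne_bot_of_le_ne_bot (WithBot.coe_ne_bot)
    (le_max_left ((Cardinal.toENat (Module.rank k (ℳ a)) - 1 : ℕ∞) : WithBot ℕ∞)
      (topologicalKrullDim (rankOneSyzygies n ℳ a))))
  rw [← hb] at key ⊢
  exact WithBot.coe_le_coe.2 (iSup₂_le fun j hj => WithBot.coe_le_coe.1 (key j hj))
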